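/- Let $\mathbb F$ be $\mathbb R$ or $\mathbb C$. **Conventions.** For families of nonnegative numbers, $\alpha_m\approx\beta_m$ means that there is a constant $C\in(0,\infty)$ with $\alpha_m\le C\beta_m$ and $\beta_m\le C\alpha_m$ for all $m\ge 1$. Let $\sigma=(s_m)_{m=1}^\infty$ be a sequence of positive numbers. It is *essentially increasing* if there is $C$ with $s_m\le C s_n$ whenever $m\le n$; its *dual sequence* is $\sigma^*=(m/s_m)_{m=1}^\infty$; it has the *LRP* if there is $r\in\mathbb N$ with $s_{rn}\ge 2s_n$ for all $n\ge1$, and the *URP* if $\sigma^*$ has the LRP. A *non-increasing weight* is a non-increasing sequence $w=(w_n)_{n=1}^\infty$ in $[0,\infty)$ with $w_1>0$; its primitive sequence $\sigma[w]$ is given by $\sigma[w]_m=\sum_{n=1}^m w_n$. Let $\mathcal X=(x_n)_{n=1}^\infty$ be a Schauder basis of a Banach space $\mathbb X$ over $\mathbb F$, with coordinate functionals $\mathcal X^*=(x_n^*)_{n=1}^\infty$ in $\mathbb X^*$, and let $S_A(f)=\sum_{n\in A}x_n^*(f)\,x_n$. Put $$\varphi_m[\mathcal X,\mathbb X]=\sup\Big\{\Big\|\sum_{n\in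 A}\varepsilon_n x_n\Big\| : |A|\le m,\ |\varepsilon_n|=1\Big\},\qquad k_m=\sup_{|A|\le m}\|S_A\|,$$ $$\tilde k_m=\sup\{\|S_A(f)\| : A\subset\mathbb N,\ \|f\|\le1,\ x_n^*(f)=0 \text{ for } n>m\}.$$ The basis is *bidemocratic* if there is $C$ with $\varphi_m[\mathcal X,\mathbb X]\,\varphi_m[\mathcal X^*,\mathbb X^*]\le Cm$ for all $m\ge 1$. It has *Property (A)* if $\|x\|=\|y\|$ whenever $x=\sum a_nx_n$ and $y=\sum b_nx_n$ in $\mathbb X$ are such that, for some bijection $\pi$ of $\mathbb N$, $|b_{\pi(n)}|=|a_n|$ for all $n$, and $\pi(k)=k$ and $b_k=a_k$ whenever $0<|a_k|<\sup_n|a_n|$. **Statement.** There exist Banach spaces $\mathbb X$ over $\mathbb F$ with a bidemocratic Schauder basis $\mathcal X$ that has Property (A) and is not unconditional. In fact, let $\sigma=(s_m)_{m=1}^\infty$ be an essentially increasing sequence of positive numbers whose dual sequence $\sigma^*$ is also essentially increasing. 1. (C.1) If $\sigma$ and $\sigma^*$ are unbounded and $w$ is a non-increasing weight with $\sigma[w]_m\approx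 s_m$, then $\mathbb X$ and $\mathcal X$ as above can be chosen so that $\varphi_m[\mathcal X,\mathbb X]=\sigma[w]_m$ for all $m\ge1$, and hence $\varphi_m[\mathcal X,\mathbb X]\approx s_m$. 2. (C.2) If $\sigma$ has the LRP and $\sigma^*$ is unbounded, then there is a non-increasing weight $w$ with $\sigma[w]_m\approx s_m$, and for each such $w$ there are $\mathbb X$ and $\mathcal X$ as in 1. 3. (C.3) If $\sigma$ has the LRP and the URP, then there is a non-increasing weight $w$ with $\sigma[w]_m\approx s_m$, and for each such $w$ there are $\mathbb X$ and $\mathcal X$ as in 1 which satisfy in addition $k_m\approx\tilde k_m\approx\log(1+m)$. -/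

import Mathlib

universe u

open scoped NNReal ENNReal

noncomputable section

/-! ### Sequences of scalars

A sequence `(s_m)_{m ≥ 1}` is a function `ℕ → ℝ` of which only the values at `m ≥ 1` matter;
the value at `0` enters none of the notions below. -/

/-- `a_m ≈ b_m` for `m ≥ 1`. -/
def SeqEquiv (a b : ℕ → ℝ) : Prop :=
  ∃ C : ℝ, 0 < C ∧ ∀ m, 1 ≤ m → a m ≤ C * b m ∧ b m ≤ C * a m

/-- `a_m ≈ b_m` for `m ≥ 1`, for quantities which are defined as suprema and are
a priori allowed to be infinite; the constant is finite. -/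
def ENNSeqEquiv (a b : ℕ → ℝ≥0∞) : Prop :=
  ∃ C : ℝ≥0, ∀ m, 1 ≤ m → a m ≤ C * b m ∧ b m ≤ C * a m

/-- Essentially increasing sequences. -/
def EssIncreasing (s : ℕ → ℝ) : Prop :=
  ∃ C : ℝ, 0 < C ∧ ∀ m n, 1 ≤ m → m ≤ n → s m ≤ C * s n

/-- The dual sequence `(n / s_n)_{n ≥ 1}`. -/
def dualSeq (s : ℕ → ℝ) (n : ℕ) : ℝ := n / s n

/-- Unboundedness (from above) of a sequence of positive numbers. -/
def UnboundedSeq (s : ℕ → ℝ) : Prop :=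
  ∀ C : ℝ, ∃ m, 1 ≤ m ∧ C < s m

/-- The lower regularity property. -/
def LRP (s : ℕ → ℝ) : Prop :=
  ∃ r : ℕ, 1 ≤ r ∧ ∀ n, 1 ≤ n → 2 * s n ≤ s (r * n)

/-- The upper regularity property. -/
def URP (s : ℕ → ℝ) : Prop := LRP (dualSeq s)

/-- Non-increasing weights `(w_n)_{n ≥ 1}`: non-negative sequences with `w_1 > 0`
that are non-increasing. -/
structure IsNonincreasingWeight (w : ℕ → ℝ) : Prop where
  nonneg : ∀ n, 1 ≤ n → 0 ≤ w n
  pos_one : 0 < w 1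
  nonincreasing : ∀ m n, 1 ≤ m → m ≤ n → w n ≤ w m

/-- The primitive sequence `∑_{n=1}^m w_n` of a weight. -/
def primitiveSeq (w : ℕ → ℝ) (m : ℕ) : ℝ := ∑ n ∈ Finset.Icc 1 m, w n

/-! ### Bases

Bases are indexed by `ℕ = {0, 1, 2, …}`, so that `b n` is the `(n+1)`-st basis vector. -/

section Bases

variable {𝕜 X : Type*} [RCLike 𝕜] [NormedAddCommGroup X] [NormedSpace 𝕜 X]

/-- The fundamental function of a sequence of vectors: the supremum of
`‖∑_{n ∈ A} ε_n x_n‖` over `|A| ≤ m` and `|ε_n| = 1`. -/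
def fundamentalFunction (𝕜 : Type*) {E : Type*} [RCLike 𝕜] [NormedAddCommGroup E]
    [NormedSpace 𝕜 E] (x : ℕ → E) (m : ℕ) : ℝ≥0∞ :=
  ⨆ (A : Finset ℕ) (_ : A.card ≤ m) (ε : ℕ → 𝕜) (_ : ∀ n ∈ A, ‖ε n‖ = 1),
    ‖∑ n ∈ A, ε n • x n‖ₑ

/-- Bidemocratic bases; the coordinate functionals are taken with the norm of the dual space. -/
def IsBidemocratic (b : SchauderBasis 𝕜 X) : Prop :=
  ∃ C : ℝ≥0, ∀ m : ℕ, 1 ≤ m →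
    fundamentalFunction 𝕜 b.basis m * fundamentalFunction 𝕜 b.coord m ≤ C * m

/-- Unconditional bases: the expansion of every vector converges unconditionally. -/
def IsUnconditional (b : SchauderBasis 𝕜 X) : Prop :=
  ∀ x : X, Summable fun n => b.coord n x • b n

/-- `y` is a greedy rearrangement of `x`: the coefficients of `x` of maximal modulus are
relocated (to positions which carry no other non-zero coefficient of `x`) and rotated,
and the remaining non-zero coefficients are untouched. The condition
`∃ n, ‖b.coord k x‖ < ‖b.coord n x‖` says that the modulus of the `k`-th coefficient is
smaller than the supremum of the moduli. -/
def IsGreedyRearrangement (b : SchauderBasis 𝕜 X) (x y : X) : Prop :=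
  ∃ π : Equiv.Perm ℕ,
    (∀ n, ‖b.coord (π n) y‖ = ‖b.coord n x‖) ∧
    ∀ k, b.coord k x ≠ 0 → (∃ n, ‖b.coord k x‖ < ‖b.coord n x‖) →
      π k = k ∧ b.coord k y = b.coord k x

/-- Property (A). -/
def HasPropertyA (b : SchauderBasis 𝕜 X) : Prop :=
  ∀ x y : X, IsGreedyRearrangement b x y → ‖x‖ = ‖y‖

/-- The unconditionality parameters `k_m = sup_{|A| ≤ m} ‖S_A‖`. -/
def uncondParam (b : SchauderBasis 𝕜 X) (m : ℕ) : ℝ≥0∞ :=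
  ⨆ (A : Finset ℕ) (_ : A.card ≤ m), ‖GeneralSchauderBasis.proj b A‖ₑ

/-- The unconditionality parameters `k̃_m`: the supremum of `‖S_A f‖` over all sets `A` and all `f`
in the unit ball supported on the first `m` basis vectors. As such an `f` is finitely supported,
finite sets `A` give all the vectors `S_A f`. -/
def uncondParamTilde (b : SchauderBasis 𝕜 X) (m : ℕ) : ℝ≥0∞ :=
  ⨆ (A : Finset ℕ) (f : X) (_ : ‖f‖ ≤ 1) (_ : ∀ n, m ≤ n → b.coord n f = 0),
    ‖GeneralSchauderBasis.proj b A f‖ₑ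

end Bases

end

/-! Write σ_m for `primitiveSeq w m`. The norm of a coefficient sequence a is the supremum, over
finite sets B and over N, of σ_{|B|}/|B| · ∑_{n∈B} |a_n| + (1/2) |∑_{n<N, n∉B} w_{|B|+n+1} a_n|. The
first part is a Marcinkiewicz norm: it is symmetric and gives bidemocracy. The second part sees
signs along initial segments and makes the basis conditional.

The weights in the second part start after position |B|. Hence the moduli of the coefficients of
each norming functional add up over a set A to at most σ_{|A|} (`sum_termCoeff_le`), which
determines the fundamental function; the terms with N = 0 bound that of the dual basis by m/σ_m.

The same shift, with the factor 1/2, gives Property (A). Moving an index of maximal modulus t into B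
raises the Marcinkiewicz part by at least t w_{|B|+1} and lowers the modulus of the conditional sum
by at most twice that (`normTerm_le_normTerm_insert`). So only sets B containing all maximal
coefficients matter, and a greedy rearrangement carries the corresponding terms into equal ones
(`normTerm_map_eq`).

For conditionality, let c be non-negative and non-increasing. The vector ∑ (-1)^k c_k x_k is
controlled by the Marcinkiewicz norm of c, while its even or its odd part has norm at least (1/4) ∑
w_{k+1} c_k. If σ and its dual are unbounded, these pairings are unbounded for c in a fixed
Marcinkiewicz ball (`exists_large_pairing`). Under both regularity properties c = 1/σ gives
logarithmic growth. No faster growth is possible: the j-th largest coefficient of x is at most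
‖x‖/σ_j, and w_j/σ_j ≤ 1/j (`sum_mul_add_le_harmonic`). -/

/-! ### A Schauder basis from a family of norming functionals -/

set_option maxHeartbeats 1000000 in
/-- A family of finitely supported functionals that is stable under truncation and contains
multiples of the coordinate functionals norms a Banach space with a Schauder basis. -/
theorem exists_schauderBasis_of_functionals {𝕜 : Type u} [RCLike 𝕜] {I : Type u}
    (h : I → ℕ → 𝕜) (D : I → ℕ) (hD : ∀ i n, D i ≤ n → h i n = 0) (C : ℝ)
    (hC : ∀ i n, ‖h i n‖ ≤ C)
    (htrunc : ∀ i M, ∃ j, ∀ n, h j n = if n < M then h i n else 0)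
    (hcoord : ∀ n, ∃ i c, c ≠ 0 ∧ ∀ k, h i k = if k = n then c else 0) :
    ∃ (X : Type u) (_ : NormedAddCommGroup X) (_ : NormedSpace 𝕜 X) (_ : CompleteSpace X)
      (b : SchauderBasis 𝕜 X), ∀ x : X,
        (∀ i, ‖∑ n ∈ Finset.range (D i), h i n * b.coord n x‖ ≤ ‖x‖) ∧
        ∀ K : ℝ, 0 ≤ K → (∀ i, ‖∑ n ∈ Finset.range (D i), h i n * b.coord n x‖ ≤ K) → ‖x‖ ≤ K := by
  classical
  let L := lp (fun _ : I => 𝕜) ∞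
  let ev : I → L →L[𝕜] 𝕜 := fun i => lp.evalCLM 𝕜 (fun _ : I => 𝕜) ∞ i
  have hev : ∀ i (x : L), ev i x = x i := fun _ _ => rfl
  -- The n-th vector lists the n-th coefficients of all functionals, so the ℓ∞ norm of a finite
  -- combination is the supremum of the functionals on it.
  let e : ℕ → L := fun n => ⟨fun i => h i n, memℓp_infty ⟨C, by rintro _ ⟨i, rfl⟩; exact hC i n⟩⟩
  have he : ∀ n i, e n i = h i n := fun _ _ => rfl
  choose κ c hc hκ using hcoord
  let coordL : ℕ → L →L[𝕜] 𝕜 := fun n => (c n)⁻¹ • ev (κ n)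
  have hortho : ∀ n k, coordL n (e k) = if k = n then 1 else 0 := by
    intro n k
    simp only [coordL, FunLike.coe_smul, Pi.smul_apply, hev, he, hκ, smul_eq_mul]
    split_ifs <;> simp [hc]
  let V : Submodule 𝕜 L := (Submodule.span 𝕜 (Set.range e)).topologicalClosure
  have heV : ∀ n, e n ∈ V := fun n =>
    Submodule.le_topologicalClosure _ (Submodule.subset_span ⟨n, rfl⟩)
  have hrep : ∀ x ∈ V, ∀ i, x i = ∑ n ∈ Finset.range (D i), h i n * coordL n x := by
    intro x hx i
    -- Evaluation at i and the finite coordinate sum are continuous and agree on every `e k`, hence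
    -- on the closed span.
    let Λ : L →L[𝕜] 𝕜 := ev i - ∑ n ∈ Finset.range (D i), h i n • coordL n
    have hle : V ≤ Λ.ker := by
      refine Submodule.topologicalClosure_minimal _ ?_ Λ.isClosed_ker
      rw [Submodule.span_le]
      rintro _ ⟨k, rfl⟩
      have : h i k = ∑ n ∈ Finset.range (D i), h i n * coordL n (e k) := by
        simp only [hortho, mul_ite, mul_one, mul_zero, Finset.sum_ite_eq, Finset.mem_range]
        split_ifs with hk
        · rfl
        · exact hD i k (not_lt.mp hk)
      simp [Λ, hev, he, ← this]
    have := hle hx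
    simpa [Λ, hev, sub_eq_zero] using this
  let P : ℕ → L →L[𝕜] L := fun M => ∑ n ∈ Finset.range M, (coordL n).smulRight (e n)
  have hP : ∀ M x, P M x = ∑ n ∈ Finset.range M, coordL n x • e n := fun M x => by
    simp [P, _root_.sum_apply]
  have hPnorm : ∀ M, ∀ x ∈ V, ‖P M x‖ ≤ ‖x‖ := by
    intro M x hx
    refine lp.norm_le_of_forall_le (norm_nonneg _) fun i => ?_
    -- The truncation of the functional i is again an index j, so entry i of `P M x` is entry j of
    -- x: the partial sum projections are contractions.
    obtain ⟨j, hj⟩ := htrunc i M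
    have : P M x i = x j := by
      rw [hrep x hx j, hP, lp.coeFn_sum, Finset.sum_apply]
      have h1 : ∑ n ∈ Finset.range M, h j n * coordL n x
          = ∑ n ∈ Finset.range (max M (D j)), h j n * coordL n x := by
        refine Finset.sum_subset (by intro n; simp; omega) fun n _ hn => ?_
        rw [hj, if_neg (by simpa using hn), zero_mul]
      have h2 : ∑ n ∈ Finset.range (D j), h j n * coordL n x
          = ∑ n ∈ Finset.range (max M (D j)), h j n * coordL n x := by
        refine Finset.sum_subset (by intro n; simp; omega) fun n _ hn => ?_
        rw [hD j n (by simpa using hn), zero_mul]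
      rw [h2, ← h1]
      refine Finset.sum_congr rfl fun n hn => ?_
      rw [hj, if_pos (Finset.mem_range.mp hn), lp.coeFn_smul, Pi.smul_apply, he, smul_eq_mul,
        mul_comm]
    rw [this]
    exact lp.norm_apply_le_norm ENNReal.top_ne_zero x j
  have hPspan : ∀ y ∈ Submodule.span 𝕜 (Set.range e), ∃ M₀, ∀ M ≥ M₀, P M y = y := by
    intro y hy
    induction hy using Submodule.span_induction with
    | mem y hy =>
      obtain ⟨k, rfl⟩ := hy
      refine ⟨k + 1, fun M hM => ?_⟩
      rw [hP]
      simp only [hortho, ite_smul, one_smul, zero_smul, Finset.sum_ite_eq, Finset.mem_range]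
      rw [if_pos (by omega)]
    | zero => exact ⟨0, fun M _ => map_zero _⟩
    | add y z _ _ hy hz =>
      obtain ⟨M, hM⟩ := hy
      obtain ⟨M', hM'⟩ := hz
      exact ⟨max M M', fun K hK => by
        rw [map_add, hM K (le_trans (le_max_left _ _) hK), hM' K (le_trans (le_max_right _ _) hK)]⟩
    | smul a y _ hy =>
      obtain ⟨M, hM⟩ := hy
      exact ⟨M, fun K hK => by rw [map_smul, hM K hK]⟩
  have hPtendsto : ∀ x ∈ V, Filter.Tendsto (fun M => P M x) Filter.atTop (nhds x) := by
    intro x hx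
    rw [Metric.tendsto_atTop]
    intro ε hε
    obtain ⟨y, hy, hxy⟩ := Metric.mem_closure_iff.mp hx (ε / 2) (half_pos hε)
    obtain ⟨M, hM⟩ := hPspan y hy
    refine ⟨M, fun K hK => ?_⟩
    have hyV : y ∈ V := Submodule.le_topologicalClosure _ hy
    have h1 := hPnorm K (x - y) (V.sub_mem hx hyV)
    rw [map_sub, hM K hK] at h1
    rw [dist_eq_norm] at hxy ⊢
    calc ‖P K x - x‖ = ‖(P K x - y) - (x - y)‖ := by congr 1; abel
      _ ≤ ‖P K x - y‖ + ‖x - y‖ := norm_sub_le _ _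
      _ < ε := by linarith
  have hcomplete : CompleteSpace V :=
    (Submodule.isClosed_topologicalClosure _).completeSpace_coe
  let b : SchauderBasis 𝕜 V :=
    { basis := fun n => ⟨e n, heV n⟩
      coord := fun n => (coordL n).comp V.subtypeL
      ortho := fun i j => by
        refine (hortho i j).trans ?_
        simp only [Pi.single_apply, eq_comm]
        congr
      expansion := fun x => by
        rw [HasSum, SummationFilter.conditional_filter_eq_map_range, Filter.tendsto_map'_iff,
          tendsto_subtype_rng]
        refine (hPtendsto x x.2).congr fun M => ?_
        simp [hP] }
  refine ⟨V, inferInstance, inferInstance, hcomplete, b, fun x => ⟨fun i => ?_, fun K hK hx => ?_⟩⟩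
  · exact (hrep x x.2 i) ▸ lp.norm_apply_le_norm ENNReal.top_ne_zero (x : L) i
  · refine lp.norm_le_of_forall_le (f := (x : L)) hK fun i => ?_
    rw [hrep x x.2 i]
    exact hx i

/-! ### Primitive sequences of non-increasing weights -/

@[simp]
theorem primitiveSeq_zero (w : ℕ → ℝ) : primitiveSeq w 0 = 0 := by simp [primitiveSeq]

theorem primitiveSeq_succ (w : ℕ → ℝ) (m : ℕ) :
    primitiveSeq w (m + 1) = primitiveSeq w m + w (m + 1) :=
  Finset.sum_Icc_succ_top (by omega) _

@[simp]
theorem primitiveSeq_one (w : ℕ → ℝ) : primitiveSeq w 1 = w 1 := by simp [primitiveSeq]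

namespace IsNonincreasingWeight

variable {w : ℕ → ℝ}

theorem primitiveSeq_monotone (hw : IsNonincreasingWeight w) : Monotone (primitiveSeq w) :=
  monotone_nat_of_le_succ fun m => by
    rw [primitiveSeq_succ]
    linarith [hw.nonneg (m + 1) (by omega)]

theorem primitiveSeq_nonneg (hw : IsNonincreasingWeight w) (m : ℕ) : 0 ≤ primitiveSeq w m := by
  simpa using hw.primitiveSeq_monotone (Nat.zero_le m)

theorem primitiveSeq_pos (hw : IsNonincreasingWeight w) {m : ℕ} (hm : 1 ≤ m) :
    0 < primitiveSeq w m := by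
  have := hw.primitiveSeq_monotone hm
  rw [primitiveSeq_one] at this
  exact hw.pos_one.trans_le this

theorem card_mul_le_primitiveSeq (hw : IsNonincreasingWeight w) {m n : ℕ} (hmn : m ≤ n) :
    m * w n ≤ primitiveSeq w m := by
  induction m with
  | zero => simp
  | succ m ih =>
    rw [primitiveSeq_succ]
    have := ih (by omega)
    have := hw.nonincreasing (m + 1) n (by omega) hmn
    push_cast
    linarith

/-- The quotients `σ[w]_m / m` are non-increasing. -/
theorem mul_primitiveSeq_le (hw : IsNonincreasingWeight w) {m n : ℕ} (hmn : m ≤ n) :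
    m * primitiveSeq w n ≤ n * primitiveSeq w m := by
  induction n, hmn using Nat.le_induction with
  | base => rfl
  | succ n hmn ih =>
    rw [primitiveSeq_succ]
    have := hw.card_mul_le_primitiveSeq (m := m) (n := n + 1) (by omega)
    push_cast
    linarith

theorem primitiveSeq_div_le (hw : IsNonincreasingWeight w) {m n : ℕ} (hm : 1 ≤ m) (hmn : m ≤ n) :
    primitiveSeq w n / n ≤ primitiveSeq w m / m := by
  have hm' : (0 : ℝ) < m := by exact_mod_cast hm
  have hn' : (0 : ℝ) < n := by exact_mod_cast hm.trans hmn
  rw [div_le_div_iff₀ hn' hm']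
  linarith [hw.mul_primitiveSeq_le hmn]

/-- Discrete concavity: a block of l weights that starts later is smaller. -/
theorem primitiveSeq_add_sub_le (hw : IsNonincreasingWeight w) {p m : ℕ} (hpm : p ≤ m) (l : ℕ) :
    primitiveSeq w (m + l) - primitiveSeq w m ≤ primitiveSeq w (p + l) - primitiveSeq w p := by
  induction l with
  | zero => simp
  | succ l ih =>
    rw [← add_assoc, ← add_assoc, primitiveSeq_succ, primitiveSeq_succ]
    linarith [hw.nonincreasing (p + l + 1) (m + l + 1) (by omega) (by omega)]

theorem sum_shift_le (hw : IsNonincreasingWeight w) (m : ℕ) (E : Finset ℕ) :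
    ∑ n ∈ E, w (m + n + 1) ≤ primitiveSeq w (m + E.card) - primitiveSeq w m := by
  induction E using Finset.induction_on_max with
  | empty => simp
  | insert q E hq ih =>
    have hqE : q ∉ E := fun h => lt_irrefl _ (hq q h)
    have hcard : E.card ≤ q := by
      simpa using Finset.card_le_card (fun x hx => Finset.mem_range.mpr (hq x hx) :
        E ⊆ Finset.range q)
    rw [Finset.sum_insert hqE, Finset.card_insert_of_notMem hqE, ← add_assoc, primitiveSeq_succ]
    linarith [hw.nonincreasing (m + E.card + 1) (m + q + 1) (by omega) (by omega)]

end IsNonincreasingWeight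

/-! ### The norming terms -/

section NormTerm

variable {𝕜 : Type*} [RCLike 𝕜]

/-- The seminorms whose supremum is the norm of the space: a symmetric Marcinkiewicz term on the
finite set `B` and a conditional term on the part of an initial segment outside `B`. -/
noncomputable def normTerm (w : ℕ → ℝ) (B : Finset ℕ) (N : ℕ) (a : ℕ → 𝕜) : ℝ :=
  primitiveSeq w B.card / B.card * ∑ n ∈ B, ‖a n‖ +
    1 / 2 * ‖∑ n ∈ Finset.range N \ B, (w (B.card + n + 1) : 𝕜) * a n‖

/-- A bound for the coefficients of the functionals which constitute `normTerm w B N`. -/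
noncomputable def termCoeff (w : ℕ → ℝ) (B : Finset ℕ) (n : ℕ) : ℝ :=
  if n ∈ B then primitiveSeq w B.card / B.card else w (B.card + n + 1)

variable {w : ℕ → ℝ}

theorem normTerm_nonneg (hw : IsNonincreasingWeight w)
    (B : Finset ℕ) (N : ℕ) (a : ℕ → 𝕜) : 0 ≤ normTerm w B N a := by
  have := hw.primitiveSeq_nonneg B.card
  unfold normTerm
  positivity

theorem termCoeff_nonneg (hw : IsNonincreasingWeight w) (B : Finset ℕ) (n : ℕ) :
    0 ≤ termCoeff w B n := by
  unfold termCoeff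
  split_ifs
  · exact div_nonneg (hw.primitiveSeq_nonneg _) (Nat.cast_nonneg _)
  · exact hw.nonneg _ (by omega)

/-- Since σ_m/m is non-increasing, A ∩ B contributes at most σ_{|A∩B|}. The weights on A \ B start
after position |B| ≥ |A ∩ B|, so by concavity they add at most σ_{|A|} - σ_{|A∩B|}. -/
theorem sum_termCoeff_le (hw : IsNonincreasingWeight w) (B A : Finset ℕ) :
    ∑ n ∈ A, termCoeff w B n ≤ primitiveSeq w A.card := by
  have hsplit := Finset.sum_inter_add_sum_sdiff A B (termCoeff w B)
  have hcard := Finset.card_inter_add_card_sdiff A B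
  have hin : ∑ n ∈ A ∩ B, termCoeff w B n ≤ primitiveSeq w (A ∩ B).card := by
    unfold termCoeff
    rw [Finset.sum_congr rfl fun n hn => if_pos (Finset.mem_inter.mp hn).2, Finset.sum_const,
      nsmul_eq_mul]
    have hle := Finset.card_le_card (Finset.inter_subset_right : A ∩ B ⊆ B)
    rcases Nat.eq_zero_or_pos B.card with h0 | hpos
    · simp [h0, hw.primitiveSeq_nonneg]
    · rw [← mul_div_assoc, div_le_iff₀ (by exact_mod_cast hpos)]
      linarith [hw.mul_primitiveSeq_le hle]
  have hout : ∑ n ∈ A \ B, termCoeff w B n ≤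
      primitiveSeq w A.card - primitiveSeq w (A ∩ B).card := by
    unfold termCoeff
    rw [Finset.sum_congr rfl fun n hn => if_neg (Finset.mem_sdiff.mp hn).2]
    refine (hw.sum_shift_le B.card _).trans ?_
    rw [← hcard]
    exact hw.primitiveSeq_add_sub_le (Finset.card_le_card Finset.inter_subset_right) _
  linarith

theorem normTerm_le_sum (hw : IsNonincreasingWeight w) {a : ℕ → 𝕜} {A : Finset ℕ}
    (ha : ∀ n, n ∉ A → a n = 0)
    (B : Finset ℕ) (N : ℕ) :
    normTerm w B N a ≤ ∑ n ∈ A, termCoeff w B n * ‖a n‖ := by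
  have hnn : ∀ n, 0 ≤ termCoeff w B n * ‖a n‖ := fun n =>
    mul_nonneg (termCoeff_nonneg hw B n) (norm_nonneg _)
  have h1 : primitiveSeq w B.card / B.card * ∑ n ∈ B, ‖a n‖ =
      ∑ n ∈ B, termCoeff w B n * ‖a n‖ := by
    rw [Finset.mul_sum]
    exact Finset.sum_congr rfl fun n hn => by rw [termCoeff, if_pos hn]
  have h2 : ‖∑ n ∈ Finset.range N \ B, (w (B.card + n + 1) : 𝕜) * a n‖ ≤
      ∑ n ∈ Finset.range N \ B, termCoeff w B n * ‖a n‖ := by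
    refine norm_sum_le_of_le _ fun n hn => ?_
    rw [termCoeff, if_neg (Finset.mem_sdiff.mp hn).2, norm_mul,
      RCLike.norm_ofReal, abs_of_nonneg (hw.nonneg _ (by omega))]
  have h3 : 0 ≤ ‖∑ n ∈ Finset.range N \ B, (w (B.card + n + 1) : 𝕜) * a n‖ := norm_nonneg _
  calc normTerm w B N a ≤ ∑ n ∈ B, termCoeff w B n * ‖a n‖ +
        ∑ n ∈ Finset.range N \ B, termCoeff w B n * ‖a n‖ := by unfold normTerm; linarith
    _ = ∑ n ∈ B ∪ (Finset.range N \ B), termCoeff w B n * ‖a n‖ :=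
        (Finset.sum_union Finset.disjoint_sdiff).symm
    _ ≤ ∑ n ∈ (B ∪ (Finset.range N \ B)) ∪ A, termCoeff w B n * ‖a n‖ :=
        Finset.sum_le_sum_of_subset_of_nonneg Finset.subset_union_left fun n _ _ => hnn n
    _ = ∑ n ∈ A, termCoeff w B n * ‖a n‖ :=
        (Finset.sum_subset Finset.subset_union_right fun n _ hn => by simp [ha n hn]).symm

end NormTerm

/-- The norm of `X` is the supremum of the seminorms `normTerm w B N` of the coefficients. -/
structure IsNormedBy {𝕜 X : Type*} [RCLike 𝕜] [NormedAddCommGroup X] [NormedSpace 𝕜 X]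
    (b : SchauderBasis 𝕜 X) (w : ℕ → ℝ) : Prop where
  term_le : ∀ (x : X) (B : Finset ℕ) (N : ℕ), normTerm w B N (fun n => b.coord n x) ≤ ‖x‖
  norm_le : ∀ (x : X) (K : ℝ),
    (∀ (B : Finset ℕ) (N : ℕ), normTerm w B N (fun n => b.coord n x) ≤ K) → ‖x‖ ≤ K

/-! ### Construction of the space -/

theorem exists_schauderBasis_isNormedBy (𝕜 : Type u) [RCLike 𝕜] {w : ℕ → ℝ}
    (hw : IsNonincreasingWeight w) :
    ∃ (X : Type u) (_ : NormedAddCommGroup X) (_ : NormedSpace 𝕜 X) (_ : CompleteSpace X)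
      (b : SchauderBasis 𝕜 X), IsNormedBy b w := by
  -- Multipliers of modulus at most 1, rather than exactly 1, make the family stable under
  -- truncation: ε is set to zero beyond M while B, and with it the shift of the weights, is kept.
  let I := Finset ℕ × {ε : ℕ → 𝕜 // ∀ n, ‖ε n‖ ≤ 1} × ℕ
  let h : I → ℕ → 𝕜 := fun i n =>
    if n ∈ i.1 then ((primitiveSeq w i.1.card / i.1.card : ℝ) : 𝕜) * i.2.1.1 n
    else if n < i.2.2 then (1 / 2 : 𝕜) * (w (i.1.card + n + 1) : 𝕜) else 0
  let D : I → ℕ := fun i => max i.2.2 (i.1.sup id + 1)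
  have hDB : ∀ (i : I) n, n ∈ i.1 → n < D i := fun i n hn =>
    lt_max_of_lt_right (Nat.lt_succ_of_le (Finset.le_sup (f := id) hn))
  have hD : ∀ i n, D i ≤ n → h i n = 0 := by
    intro i n hn
    have h1 : n ∉ i.1 := fun hmem => absurd (hDB i n hmem) (not_lt.mpr hn)
    have h2 : ¬ n < i.2.2 := not_lt.mpr ((le_max_left _ _).trans hn)
    simp [h, h1, h2]
  have hC : ∀ i n, ‖h i n‖ ≤ w 1 := by
    intro i n
    have h1 := sum_termCoeff_le hw i.1 {n}
    simp only [Finset.sum_singleton, Finset.card_singleton, primitiveSeq_one, termCoeff] at h1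
    by_cases hn : n ∈ i.1
    · rw [if_pos hn] at h1
      simp only [h, if_pos hn, norm_mul, RCLike.norm_ofReal]
      rw [abs_of_nonneg (div_nonneg (hw.primitiveSeq_nonneg _) (Nat.cast_nonneg _))]
      exact (mul_le_of_le_one_right
        (div_nonneg (hw.primitiveSeq_nonneg _) (Nat.cast_nonneg _)) (i.2.1.2 n)).trans h1
    · rw [if_neg hn] at h1
      simp only [h, if_neg hn]
      split_ifs
      · have := hw.nonneg (i.1.card + n + 1) (by omega)
        rw [norm_mul, RCLike.norm_ofReal, abs_of_nonneg this]
        simp only [norm_div, norm_one, RCLike.norm_ofNat]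
        linarith
      · simpa using hw.pos_one.le
  have htrunc : ∀ i M, ∃ j, ∀ n, h j n = if n < M then h i n else 0 := by
    rintro ⟨B, ε, N⟩ M
    refine ⟨⟨B, ⟨fun n => if n < M then ε.1 n else 0, fun n => ?_⟩, min N M⟩, fun n => ?_⟩
    · beta_reduce
      split_ifs
      · exact ε.2 n
      · simp
    · by_cases hn : n ∈ B <;> by_cases hM : n < M <;> simp [h, hn, hM]
  have hcoord : ∀ n, ∃ i c, c ≠ 0 ∧ ∀ k, h i k = if k = n then c else 0 := by
    intro n
    refine ⟨⟨{n}, ⟨fun _ => 1, fun _ => by simp⟩, 0⟩, (w 1 : 𝕜), ?_, fun k => ?_⟩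
    · exact_mod_cast hw.pos_one.ne'
    · simp [h]
  have hsum : ∀ (i : I) (a : ℕ → 𝕜), ∑ n ∈ Finset.range (D i), h i n * a n =
      ((primitiveSeq w i.1.card / i.1.card : ℝ) : 𝕜) * ∑ n ∈ i.1, i.2.1.1 n * a n +
      (1 / 2 : 𝕜) * ∑ n ∈ Finset.range i.2.2 \ i.1, (w (i.1.card + n + 1) : 𝕜) * a n := by
    intro i a
    have hsub : i.1 ∪ (Finset.range i.2.2 \ i.1) ⊆ Finset.range (D i) := by
      intro n hn
      rcases Finset.mem_union.mp hn with hn | hn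
      · exact Finset.mem_range.mpr (hDB i n hn)
      · exact Finset.mem_range.mpr
          (lt_max_of_lt_left (Finset.mem_range.mp (Finset.mem_sdiff.mp hn).1))
    rw [← Finset.sum_subset hsub, Finset.sum_union Finset.disjoint_sdiff, Finset.mul_sum,
      Finset.mul_sum]
    · congr 1
      · exact Finset.sum_congr rfl fun n hn => by simp only [h, if_pos hn, mul_assoc]
      · refine Finset.sum_congr rfl fun n hn => ?_
        rw [Finset.mem_sdiff, Finset.mem_range] at hn
        simp only [h, if_neg hn.2, if_pos hn.1, mul_assoc]
    · intro n _ hn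
      simp only [Finset.mem_union, Finset.mem_sdiff, Finset.mem_range] at hn
      push Not at hn
      have h1 : ¬ n < i.2.2 := fun hlt => hn.1 (hn.2 hlt)
      simp [h, hn.1, h1]
  obtain ⟨X, i₁, i₂, i₃, b, hb⟩ := exists_schauderBasis_of_functionals h D hD (w 1) hC htrunc hcoord
  refine ⟨X, i₁, i₂, i₃, b, ⟨fun x B N => ?_, fun x K hK => ?_⟩⟩
  · set a : ℕ → 𝕜 := fun n => b.coord n x
    set Z : 𝕜 := ∑ n ∈ Finset.range N \ B, (w (B.card + n + 1) : 𝕜) * a n with hZ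
    -- Rotating each a n to the phase of Z aligns both parts of the functional, so that its modulus
    -- is the full seminorm.
    have hphase : ∀ z : 𝕜, ∃ θ : 𝕜, ‖θ‖ = 1 ∧ z = θ * ‖z‖ := by
      intro z
      by_cases hz : z = 0
      · exact ⟨1, by simp, by simp [hz]⟩
      · refine ⟨z / ‖z‖, ?_, ?_⟩
        · simp [hz]
        · have : ((‖z‖ : ℝ) : 𝕜) ≠ 0 := by exact_mod_cast norm_ne_zero_iff.mpr hz
          field_simp
    choose θ hθ hθz using hphase
    have hε : ∀ n, θ Z * (starRingEnd 𝕜) (θ (a n)) * a n = θ Z * ‖a n‖ := by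
      intro n
      have h1 : (starRingEnd 𝕜) (θ (a n)) * θ (a n) = 1 := by
        rw [RCLike.conj_mul, hθ]; simp
      calc θ Z * (starRingEnd 𝕜) (θ (a n)) * a n
          = θ Z * (starRingEnd 𝕜) (θ (a n)) * (θ (a n) * ‖a n‖) := by rw [← hθz]
        _ = θ Z * ((starRingEnd 𝕜) (θ (a n)) * θ (a n)) * ‖a n‖ := by ring
        _ = θ Z * ‖a n‖ := by rw [h1, mul_one]
    have := (hb x).1 ⟨B, ⟨fun n => θ Z * (starRingEnd 𝕜) (θ (a n)), fun n => by simp [hθ]⟩, N⟩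
    rw [hsum] at this
    simp only at this
    rw [Finset.sum_congr rfl fun n _ => hε n, ← Finset.mul_sum, ← hZ] at this
    have hval : ((primitiveSeq w B.card / B.card : ℝ) : 𝕜) * (θ Z * ∑ n ∈ B, ((‖a n‖ : ℝ) : 𝕜)) +
        1 / 2 * Z = θ Z * ((normTerm w B N a : ℝ) : 𝕜) := by
      have hZ' : Z = θ Z * ((‖Z‖ : ℝ) : 𝕜) := hθz Z
      unfold normTerm
      rw [← hZ]
      push_cast
      nth_rewrite 2 [hZ']
      ring
    rw [hval, norm_mul, hθ, one_mul, RCLike.norm_ofReal,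
      abs_of_nonneg (normTerm_nonneg hw B N a)] at this
    exact this
  · have hK0 : 0 ≤ K := (normTerm_nonneg hw ∅ 0 _).trans (hK ∅ 0)
    refine (hb x).2 K hK0 fun i => ?_
    refine le_trans ?_ (hK i.1 i.2.2)
    rw [hsum]
    refine (norm_add_le _ _).trans (add_le_add ?_ ?_)
    · rw [norm_mul, RCLike.norm_ofReal,
        abs_of_nonneg (div_nonneg (hw.primitiveSeq_nonneg _) (Nat.cast_nonneg _))]
      refine mul_le_mul_of_nonneg_left ?_
        (div_nonneg (hw.primitiveSeq_nonneg _) (Nat.cast_nonneg _))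
      refine norm_sum_le_of_le _ fun n _ => ?_
      rw [norm_mul]
      exact mul_le_of_le_one_left (norm_nonneg _) (i.2.1.2 n)
    · rw [norm_mul]
      simp

section Basis

variable {𝕜 X : Type*} [RCLike 𝕜] [NormedAddCommGroup X] [NormedSpace 𝕜 X]

theorem SchauderBasis.coord_sum_smul (b : SchauderBasis 𝕜 X) (A : Finset ℕ) (c : ℕ → 𝕜) (k : ℕ) :
    b.coord k (∑ n ∈ A, c n • b n) = if k ∈ A then c k else 0 := by
  simp [b.ortho, Pi.single_apply]

variable {b : SchauderBasis 𝕜 X} {w : ℕ → ℝ}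

/-! ### Fundamental functions -/

theorem IsNormedBy.norm_sum_smul_le (hb : IsNormedBy b w) (hw : IsNonincreasingWeight w)
    {A : Finset ℕ} {ε : ℕ → 𝕜} (hε : ∀ n ∈ A, ‖ε n‖ = 1) :
    ‖∑ n ∈ A, ε n • b n‖ ≤ primitiveSeq w A.card := by
  refine hb.norm_le _ _ fun B N => ?_
  simp only [SchauderBasis.coord_sum_smul]
  refine (normTerm_le_sum hw (A := A) (fun n hn => if_neg hn) B N).trans ?_
  refine le_trans (le_of_eq ?_) (sum_termCoeff_le hw B A)
  exact Finset.sum_congr rfl fun n hn => by rw [if_pos hn, hε n hn, mul_one]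

theorem IsNormedBy.fundamentalFunction_eq (hb : IsNormedBy b w) (hw : IsNonincreasingWeight w)
    {m : ℕ} (hm : 1 ≤ m) :
    fundamentalFunction 𝕜 b.basis m = ENNReal.ofReal (primitiveSeq w m) := by
  apply le_antisymm
  · refine iSup₂_le fun A hA => iSup₂_le fun ε hε => ?_
    rw [← ofReal_norm]
    exact ENNReal.ofReal_le_ofReal
      ((hb.norm_sum_smul_le hw hε).trans (hw.primitiveSeq_monotone hA))
  · refine le_trans ?_ (le_iSup₂_of_le (Finset.range m) (by simp)
      (le_iSup₂_of_le (fun _ => (1 : 𝕜)) (by simp) le_rfl))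
    rw [← ofReal_norm]
    refine ENNReal.ofReal_le_ofReal ?_
    refine le_trans (le_of_eq ?_) (hb.term_le _ (Finset.range m) 0)
    simp only [SchauderBasis.coord_sum_smul, normTerm]
    have hm' : (m : ℝ) ≠ 0 := by exact_mod_cast (by omega : m ≠ 0)
    rw [Finset.sum_congr rfl fun n hn => by rw [if_pos hn, norm_one]]
    simp [hm']

theorem IsNormedBy.primitiveSeq_mul_sum_le (hb : IsNormedBy b w) (x : X) (A : Finset ℕ) :
    primitiveSeq w A.card * ∑ n ∈ A, ‖b.coord n x‖ ≤ A.card * ‖x‖ := by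
  rcases Nat.eq_zero_or_pos A.card with h0 | hpos
  · simp [h0]
  · have h := hb.term_le x A 0
    simp only [normTerm, Finset.range_zero, Finset.empty_sdiff, Finset.sum_empty, norm_zero,
      mul_zero, add_zero] at h
    have hA : (0 : ℝ) < A.card := by exact_mod_cast hpos
    rw [div_mul_eq_mul_div, div_le_iff₀ hA] at h
    linarith

/-- The terms with N = 0 bound ∑_{n∈A} |a_n| by ‖x‖ |A|/σ_{|A|}, and m/σ_m is non-decreasing. -/
theorem IsNormedBy.fundamentalFunction_coord_le (hb : IsNormedBy b w)
    (hw : IsNonincreasingWeight w) {m : ℕ} (hm : 1 ≤ m) :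
    fundamentalFunction 𝕜 b.coord m ≤ ENNReal.ofReal (m / primitiveSeq w m) := by
  have hsm := hw.primitiveSeq_pos hm
  refine iSup₂_le fun A hA => iSup₂_le fun ε hε => ?_
  rw [← ofReal_norm]
  refine ENNReal.ofReal_le_ofReal
    (ContinuousLinearMap.opNorm_le_bound _ (by positivity) fun x => ?_)
  have h1 : ‖(∑ n ∈ A, ε n • b.coord n) x‖ ≤ ∑ n ∈ A, ‖b.coord n x‖ := by
    rw [_root_.sum_apply]
    refine norm_sum_le_of_le _ fun n hn => ?_
    simp [hε n hn]
  refine h1.trans ?_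
  rcases Nat.eq_zero_or_pos A.card with h0 | hpos
  · rw [Finset.card_eq_zero.mp h0]
    simp only [Finset.sum_empty]
    positivity
  · have h2 := hb.primitiveSeq_mul_sum_le x A
    have hsA := hw.primitiveSeq_pos hpos
    have h3 := mul_le_mul_of_nonneg_right (hw.mul_primitiveSeq_le hA) (norm_nonneg x)
    rw [div_mul_eq_mul_div, le_div_iff₀ hsm]
    refine le_of_mul_le_mul_left ?_ hsA
    calc primitiveSeq w A.card * ((∑ n ∈ A, ‖b.coord n x‖) * primitiveSeq w m)
        = (primitiveSeq w A.card * ∑ n ∈ A, ‖b.coord n x‖) * primitiveSeq w m := by ring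
      _ ≤ (A.card * ‖x‖) * primitiveSeq w m := mul_le_mul_of_nonneg_right h2 hsm.le
      _ ≤ primitiveSeq w A.card * (m * ‖x‖) := by linarith

theorem IsNormedBy.isBidemocratic (hb : IsNormedBy b w) (hw : IsNonincreasingWeight w) :
    IsBidemocratic b := by
  refine ⟨1, fun m hm => ?_⟩
  have hsm := hw.primitiveSeq_pos hm
  rw [hb.fundamentalFunction_eq hw hm]
  refine (mul_le_mul_right (hb.fundamentalFunction_coord_le hw hm) _).trans ?_
  rw [← ENNReal.ofReal_mul hsm.le, mul_div_cancel₀ _ hsm.ne']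
  simp

/-! ### Property (A) -/

/-- The factor 1/2 in `normTerm` is chosen for this: the conditional sum can lose t w_{m+1} through
the shift of the weights and t w_{m+1} through the removal of q, and half of this total is what the
Marcinkiewicz part gains. -/
theorem normTerm_le_normTerm_insert (hw : IsNonincreasingWeight w) {a : ℕ → 𝕜} {t : ℝ}
    (ha : ∀ n, ‖a n‖ ≤ t) {B : Finset ℕ} {q : ℕ} (hq : q ∉ B) (hqt : ‖a q‖ = t) (N : ℕ) :
    normTerm w B N a ≤ normTerm w (insert q B) N a := by
  have ht : 0 ≤ t := hqt ▸ norm_nonneg _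
  unfold normTerm
  rw [Finset.card_insert_of_notMem hq, Finset.sum_insert hq, hqt]
  set m := B.card with hm
  have hw0 : 0 ≤ w (m + 1) := hw.nonneg _ (by omega)
  -- As σ_{m+1}/(m+1) ≤ σ_m/m, the gain is smallest when the sum over B is m t, and there it equals
  -- t (σ_{m+1} - σ_m).
  have hfirst : primitiveSeq w m / m * ∑ n ∈ B, ‖a n‖ + t * w (m + 1) ≤
      primitiveSeq w (m + 1) / ((m + 1 : ℕ) : ℝ) * (t + ∑ n ∈ B, ‖a n‖) := by
    rcases Nat.eq_zero_or_pos m with h0 | hpos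
    · have : B = ∅ := Finset.card_eq_zero.mp (hm ▸ h0)
      simp [this, h0, mul_comm]
    · have hS : ∑ n ∈ B, ‖a n‖ ≤ m * t := by
        simpa using Finset.sum_le_card_nsmul B _ t fun n _ => ha n
      have hm0 : (0 : ℝ) < m := by exact_mod_cast hpos
      have hdiv := hw.primitiveSeq_div_le hpos (Nat.le_succ m)
      have hprod := mul_nonneg (sub_nonneg.mpr hdiv) (sub_nonneg.mpr hS)
      have e1 : primitiveSeq w m / m * (m * t) = primitiveSeq w m * t := by field_simp
      have e2 : primitiveSeq w (m + 1) / ((m + 1 : ℕ) : ℝ) * (m * t) +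
          primitiveSeq w (m + 1) / ((m + 1 : ℕ) : ℝ) * t = primitiveSeq w (m + 1) * t := by
        push_cast
        field_simp
      have e3 : primitiveSeq w (m + 1) * t = (primitiveSeq w m + w (m + 1)) * t := by
        rw [primitiveSeq_succ]
      nlinarith
  set Z : 𝕜 := ∑ n ∈ Finset.range N \ B, (w (m + n + 1) : 𝕜) * a n
  set Z' : 𝕜 := ∑ n ∈ Finset.range N \ insert q B, (w (m + 1 + n + 1) : 𝕜) * a n with hZ'
  -- Intermediate sum: the weights are already shifted, but q is still present. The passage from Z
  -- to Z'' is bounded by a telescoping sum of weight differences.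
  set Z'' : 𝕜 := ∑ n ∈ Finset.range N \ B, (w (m + 1 + n + 1) : 𝕜) * a n with hZ''
  have hstep : ∀ n, 0 ≤ w (m + n + 1) - w (m + 1 + n + 1) := fun n =>
    sub_nonneg.mpr (hw.nonincreasing _ _ (by omega) (by omega))
  have h1 : ‖Z - Z''‖ ≤ t * w (m + 1) := by
    rw [← Finset.sum_sub_distrib]
    calc ‖∑ n ∈ Finset.range N \ B,
          ((w (m + n + 1) : 𝕜) * a n - (w (m + 1 + n + 1) : 𝕜) * a n)‖
        ≤ ∑ n ∈ Finset.range N \ B, (w (m + n + 1) - w (m + 1 + n + 1)) * t := by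
          refine norm_sum_le_of_le _ fun n _ => ?_
          rw [← sub_mul, ← RCLike.ofReal_sub, norm_mul, RCLike.norm_ofReal, abs_of_nonneg (hstep n)]
          exact mul_le_mul_of_nonneg_left (ha n) (hstep n)
      _ ≤ ∑ n ∈ Finset.range N, (w (m + n + 1) - w (m + 1 + n + 1)) * t :=
          Finset.sum_le_sum_of_subset_of_nonneg Finset.sdiff_subset fun n _ _ =>
            mul_nonneg (hstep n) ht
      _ = (w (m + 1) - w (m + N + 1)) * t := by
          rw [← Finset.sum_mul]
          congr 1
          have := Finset.sum_range_sub' (fun n => w (m + n + 1)) N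
          simp only [add_zero] at this
          rw [← this]
          exact Finset.sum_congr rfl fun n _ => by rw [show m + 1 + n + 1 = m + (n + 1) + 1 by ring]
      _ ≤ t * w (m + 1) := by
          have := hw.nonneg (m + N + 1) (by omega)
          nlinarith
  have h2 : ‖Z'' - Z'‖ ≤ t * w (m + 1) := by
    by_cases hqN : q < N
    · have hmem : q ∈ Finset.range N \ B := by simp [hqN, hq]
      have : Finset.range N \ insert q B = (Finset.range N \ B).erase q := by
        ext n
        simp only [Finset.mem_sdiff, Finset.mem_insert, Finset.mem_erase]
        tauto
      rw [hZ', this, hZ'', ← Finset.add_sum_erase _ _ hmem, add_sub_cancel_right, norm_mul,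
        RCLike.norm_ofReal, hqt, abs_of_nonneg (hw.nonneg _ (by omega)), mul_comm]
      exact mul_le_mul_of_nonneg_left (hw.nonincreasing _ _ (by omega) (by omega)) ht
    · have : Finset.range N \ insert q B = Finset.range N \ B := by
        ext n
        simp only [Finset.mem_sdiff, Finset.mem_insert, Finset.mem_range]
        constructor
        · tauto
        · rintro ⟨hn, hnB⟩
          exact ⟨hn, by rintro (rfl | h) <;> tauto⟩
      rw [hZ', this, ← hZ'', sub_self, norm_zero]
      positivity
  have h3 : ‖Z‖ ≤ ‖Z - Z''‖ + ‖Z'' - Z'‖ + ‖Z'‖ := by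
    calc ‖Z‖ = ‖(Z - Z'') + (Z'' - Z') + Z'‖ := by congr 1; ring
      _ ≤ _ := norm_add₃_le
  linarith

theorem normTerm_le_normTerm_union (hw : IsNonincreasingWeight w) {a : ℕ → 𝕜} {t : ℝ}
    (ha : ∀ n, ‖a n‖ ≤ t) (B : Finset ℕ) {A : Finset ℕ} (hA : ∀ q ∈ A, ‖a q‖ = t) (N : ℕ) :
    normTerm w B N a ≤ normTerm w (A ∪ B) N a := by
  induction A using Finset.induction_on with
  | empty => simp
  | insert q A hq ih =>
    refine (ih fun n hn => hA n (Finset.mem_insert_of_mem hn)).trans ?_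
    rw [Finset.insert_union]
    by_cases hqB : q ∈ A ∪ B
    · rw [Finset.insert_eq_of_mem hqB]
    · exact normTerm_le_normTerm_insert hw ha hqB (hA q (Finset.mem_insert_self _ _)) N

/-- Once B contains every coefficient of modulus t, the permutation fixes all non-zero coefficients
outside B. Replacing B by its image keeps the cardinality, hence the weights, and the sequence
outside the set. -/
theorem normTerm_map_eq {a a' : ℕ → 𝕜} {t : ℝ} {π : Equiv.Perm ℕ} {B : Finset ℕ}
    (hB : ∀ n, ‖a n‖ = t → n ∈ B) (hnorm : ∀ n, ‖a' (π n)‖ = ‖a n‖)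
    (hfix : ∀ k, a k ≠ 0 → ‖a k‖ ≠ t → π k = k ∧ a' k = a k) (N : ℕ) :
    normTerm w (B.map π.toEmbedding) N a' = normTerm w B N a := by
  have hout : ∀ k, k ∉ B → a k ≠ 0 → π k = k ∧ a' k = a k := fun k hk h0 =>
    hfix k h0 fun h => hk (hB k h)
  have hmem : ∀ n, n ∈ B.map π.toEmbedding ↔ π.symm n ∈ B := by
    intro n
    simp [Finset.mem_map_equiv]
  have hnorm' : ∀ n, ‖a' n‖ = ‖a (π.symm n)‖ := fun n => by
    rw [← hnorm, Equiv.apply_symm_apply]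
  have hzero : ∀ n, π.symm n ∉ B → π.symm n ≠ n → a' n = 0 := by
    intro n h1 h2
    rw [← norm_eq_zero, hnorm', norm_eq_zero]
    by_contra h3
    have := (hout _ h1 h3).1
    rw [Equiv.apply_symm_apply] at this
    exact h2 this.symm
  have hpt : ∀ n, (if n ∈ B.map π.toEmbedding then 0 else a' n) = if n ∈ B then 0 else a n := by
    intro n
    by_cases hfixed : π.symm n = n
    · simp only [hmem, hfixed]
      split_ifs with hn
      · rfl
      · by_cases h0 : a n = 0
        · rw [h0, ← norm_eq_zero, hnorm', hfixed, h0, norm_zero]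
        · exact (hout n hn h0).2
    · have hn0 : n ∉ B → a n = 0 := by
        intro hn
        by_contra h0
        exact hfixed (by rw [Equiv.symm_apply_eq, (hout n hn h0).1])
      simp only [hmem]
      split_ifs with h1 h2 h2
      · rfl
      · exact (hn0 h2).symm
      · exact hzero n h1 hfixed
      · rw [hzero n h1 hfixed, hn0 h2]
  have hsum : ∀ (E : Finset ℕ) (c a : ℕ → 𝕜), ∑ n ∈ Finset.range N \ E, c n * a n =
      ∑ n ∈ Finset.range N, c n * if n ∈ E then 0 else a n := by
    intro E c a
    rw [Finset.sdiff_eq_filter, Finset.sum_filter]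
    exact Finset.sum_congr rfl fun n _ => by by_cases h : n ∈ E <;> simp [h]
  unfold normTerm
  rw [Finset.card_map, Finset.sum_map, hsum _ (fun n => (w (B.card + n + 1) : 𝕜)),
    hsum _ (fun n => (w (B.card + n + 1) : 𝕜))]
  simp only [hpt, Equiv.coe_toEmbedding, hnorm]

theorem IsNormedBy.tendsto_coord (hb : IsNormedBy b w) (hw : IsNonincreasingWeight w) (x : X) :
    Filter.Tendsto (fun n => b.coord n x) Filter.atTop (nhds 0) := by
  have h := SchauderBasis.tendsto_proj b x
  have h' := ((Filter.tendsto_add_atTop_iff_nat 1).mpr h).sub h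
  rw [sub_self] at h'
  have h2 : Filter.Tendsto (fun n => b.coord n x • b n) Filter.atTop (nhds 0) := by
    refine h'.congr fun n => ?_
    rw [SchauderBasis.proj_apply, SchauderBasis.proj_apply, Finset.sum_range_succ,
      add_sub_cancel_left]
  have h3 : Filter.Tendsto (fun n => (w 1)⁻¹ * ‖b.coord n x • b n‖) Filter.atTop (nhds 0) := by
    simpa using h2.norm.const_mul ((w 1)⁻¹)
  refine squeeze_zero_norm (fun n => ?_) h3
  have h4 := hb.primitiveSeq_mul_sum_le (b.coord n x • b n) {n}
  simp only [Finset.card_singleton, primitiveSeq_one, Finset.sum_singleton, map_smul, b.ortho,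
    Pi.single_eq_same, smul_eq_mul, mul_one, Nat.cast_one, one_mul] at h4
  rw [inv_mul_eq_div, le_div_iff₀ hw.pos_one]
  linarith

theorem IsGreedyRearrangement.symm {x y : X} (h : IsGreedyRearrangement b x y) :
    IsGreedyRearrangement b y x := by
  obtain ⟨π, hnorm, hfix⟩ := h
  have hnorm' : ∀ n, ‖b.coord (π.symm n) x‖ = ‖b.coord n y‖ := fun n => by
    rw [← hnorm, Equiv.apply_symm_apply]
  refine ⟨π.symm, hnorm', fun k hk ⟨n, hn⟩ => ?_⟩
  have h1 : b.coord (π.symm k) x ≠ 0 := by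
    rw [← norm_ne_zero_iff, hnorm', norm_ne_zero_iff]
    exact hk
  obtain ⟨h2, h3⟩ := hfix _ h1 ⟨π.symm n, by rwa [hnorm', hnorm']⟩
  rw [Equiv.apply_symm_apply] at h2
  rw [← h2] at h3
  exact ⟨h2.symm, h3.symm⟩

/-- The coefficients tend to zero, so for x ≠ 0 the maximal modulus is attained, on a finite set
that can be added to any B. The reverse inequality follows by symmetry of the relation. -/
theorem IsNormedBy.norm_le_of_isGreedyRearrangement (hb : IsNormedBy b w)
    (hw : IsNonincreasingWeight w) {x y : X} (h : IsGreedyRearrangement b x y) : ‖x‖ ≤ ‖y‖ := by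
  obtain ⟨π, hnorm, hfix⟩ := h
  by_cases hx : ∀ n, b.coord n x = 0
  · refine hb.norm_le x _ fun B N => ?_
    simp [normTerm, hx]
  push Not at hx
  obtain ⟨k, hk⟩ := hx
  have hfin : {n | ‖b.coord k x‖ ≤ ‖b.coord n x‖}.Finite := by
    have h0 := (hb.tendsto_coord hw x).norm
    rw [norm_zero] at h0
    have := h0.eventually (gt_mem_nhds (norm_pos_iff.mpr hk))
    rw [← Nat.cofinite_eq_atTop, Filter.eventually_cofinite] at this
    simpa using this
  obtain ⟨q, hq, hmax⟩ := hfin.exists_maximalFor (fun n => ‖b.coord n x‖) _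
    ⟨k, le_refl ‖b.coord k x‖⟩
  have hle : ∀ n, ‖b.coord n x‖ ≤ ‖b.coord q x‖ := by
    intro n
    rcases le_total ‖b.coord n x‖ ‖b.coord q x‖ with h | h
    · exact h
    · exact hmax (le_trans (show ‖b.coord k x‖ ≤ ‖b.coord q x‖ from hq) h) h
  have hfinA : {n | ‖b.coord n x‖ = ‖b.coord q x‖}.Finite :=
    hfin.subset fun n hn => by
      rw [Set.mem_ofPred_eq] at hn hq ⊢
      rwa [hn]
  refine hb.norm_le x _ fun B N => ?_
  refine (normTerm_le_normTerm_union hw hle B (A := hfinA.toFinset) (by simp) N).trans ?_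
  rw [← normTerm_map_eq (a' := fun n => b.coord n y) (t := ‖b.coord q x‖) (π := π)]
  · exact hb.term_le y _ N
  · intro n hn
    simp [hn]
  · exact hnorm
  · exact fun j hj hne => hfix j hj ⟨q, lt_of_le_of_ne (hle j) hne⟩

theorem IsNormedBy.hasPropertyA (hb : IsNormedBy b w) (hw : IsNonincreasingWeight w) :
    HasPropertyA b := fun _ _ h =>
  le_antisymm (hb.norm_le_of_isGreedyRearrangement hw h)
    (hb.norm_le_of_isGreedyRearrangement hw h.symm)

end Basis

theorem primitiveSeq_eq_sum_range (w : ℕ → ℝ) (m : ℕ) :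
    primitiveSeq w m = ∑ k ∈ Finset.range m, w (k + 1) := by
  induction m with
  | zero => simp
  | succ m ih => rw [primitiveSeq_succ, Finset.sum_range_succ, ih]

section Parameters

variable {𝕜 X : Type*} [RCLike 𝕜] [NormedAddCommGroup X] [NormedSpace 𝕜 X]
  {b : SchauderBasis 𝕜 X} {w : ℕ → ℝ}

/-! ### Upper bounds for the unconditionality parameters -/

theorem uncondParamTilde_le_uncondParam (b : SchauderBasis 𝕜 X) (m : ℕ) :
    uncondParamTilde b m ≤ uncondParam b m := by
  refine iSup₂_le fun A f => iSup₂_le fun hf hm => ?_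
  refine le_iSup₂_of_le (A ∩ Finset.range m)
    (by simpa using Finset.card_le_card (Finset.inter_subset_right (s₁ := A)
      (s₂ := Finset.range m))) ?_
  have : GeneralSchauderBasis.proj b A f = GeneralSchauderBasis.proj b (A ∩ Finset.range m) f := by
    rw [GeneralSchauderBasis.proj_apply, GeneralSchauderBasis.proj_apply]
    refine (Finset.sum_subset Finset.inter_subset_left fun n hn hn' => ?_).symm
    rw [hm n (by simpa [hn] using hn'), zero_smul]
  rw [this, ← ofReal_norm, ← ofReal_norm]
  exact ENNReal.ofReal_le_ofReal (ContinuousLinearMap.unit_le_opNorm _ f hf)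

/-- Summation by parts against a decreasing enumeration of `a`. -/
theorem sum_mul_add_le_harmonic (hw : IsNonincreasingWeight w) {h a : ℕ → ℝ} {K : ℝ} (hK : 0 ≤ K)
    (hh : ∀ A : Finset ℕ, ∑ n ∈ A, h n ≤ primitiveSeq w A.card)
    (ha : ∀ (A : Finset ℕ) (τ : ℝ), (∀ n ∈ A, τ ≤ a n) → primitiveSeq w A.card * τ ≤ K)
    (A : Finset ℕ) {τ : ℝ} (hτ : ∀ n ∈ A, τ ≤ a n) :
    ∑ n ∈ A, h n * a n + (primitiveSeq w A.card - ∑ n ∈ A, h n) * τ ≤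
      K * (harmonic A.card : ℝ) := by
  induction hA : A.card generalizing A τ with
  | zero =>
    rw [Finset.card_eq_zero] at hA
    simp [hA]
  | succ j ih =>
    have hne : A.Nonempty := Finset.card_pos.mp (by omega)
    -- The smallest value `a q` becomes the threshold for the remaining set. The slack σ_{|A|} - ∑ h
    -- is non-negative, so the threshold may afterwards be lowered to τ.
    obtain ⟨q, hq, hmin⟩ := A.exists_min_image a hne
    have hcard : (A.erase q).card = j := by rw [Finset.card_erase_of_mem hq, hA]; rfl
    have hrec := ih (A.erase q) (τ := a q) (fun n hn => hmin n (Finset.mem_of_mem_erase hn)) hcard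
    have hsum1 := Finset.add_sum_erase A (fun n => h n * a n) hq
    have hsum2 := Finset.add_sum_erase A h hq
    have hgap := hh A
    rw [hA, primitiveSeq_succ] at hgap
    have hlast := ha A (a q) hmin
    rw [hA] at hlast
    -- Combines (j+1) w_{j+1} ≤ σ_{j+1} with σ_{j+1} a_q ≤ K.
    have hstep : w (j + 1) * a q ≤ K * ((j + 1 : ℝ))⁻¹ := by
      have h1 := hw.card_mul_le_primitiveSeq (le_refl (j + 1))
      have hw0 := hw.nonneg (j + 1) (by omega)
      have hj : (0 : ℝ) < j + 1 := by positivity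
      rw [← div_eq_mul_inv, le_div_iff₀ hj]
      push_cast at h1
      rcases le_total 0 (a q) with h0 | h0
      · nlinarith
      · nlinarith [mul_nonneg hw0 (neg_nonneg.mpr h0)]
    have hτq := hτ q hq
    rw [harmonic_succ, primitiveSeq_succ]
    push_cast
    rw [mul_add, ← hsum1, ← hsum2]
    rw [← hsum2] at hgap
    have := mul_le_mul_of_nonneg_left hτq (sub_nonneg.mpr hgap)
    linarith

/-- Only the Marcinkiewicz part of ‖x‖ is used: it bounds σ_{|E|} times any common non-negative
lower bound of the moduli on E by ‖x‖. -/
theorem IsNormedBy.norm_proj_le (hb : IsNormedBy b w) (hw : IsNonincreasingWeight w)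
    (A : Finset ℕ) : ‖GeneralSchauderBasis.proj b A‖ ≤ (harmonic A.card : ℝ) := by
  have hH : (0 : ℝ) ≤ (harmonic A.card : ℝ) := by
    unfold harmonic
    push_cast
    positivity
  refine ContinuousLinearMap.opNorm_le_bound _ hH fun x => ?_
  refine hb.norm_le _ _ fun B N => ?_
  simp only [GeneralSchauderBasis.proj_apply, SchauderBasis.coord_sum_smul b A]
  refine (normTerm_le_sum hw (A := A) (fun n hn => if_neg hn) B N).trans ?_
  have h := sum_mul_add_le_harmonic hw (h := termCoeff w B) (a := fun n => ‖b.coord n x‖)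
    (norm_nonneg x) (sum_termCoeff_le hw B) (fun E τ hτ => ?_) A (τ := 0) (by simp)
  · rw [mul_zero, add_zero, mul_comm] at h
    refine le_trans (le_of_eq ?_) h
    exact Finset.sum_congr rfl fun n hn => by rw [if_pos hn]
  · have h1 := hb.primitiveSeq_mul_sum_le x E
    have h2 : E.card * τ ≤ ∑ n ∈ E, ‖b.coord n x‖ := by
      simpa using Finset.card_nsmul_le_sum E _ τ hτ
    rcases Nat.eq_zero_or_pos E.card with h0 | hpos
    · simp [h0]
    · have hE : (0 : ℝ) < E.card := by exact_mod_cast hpos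
      have h3 := mul_le_mul_of_nonneg_left h2 (hw.primitiveSeq_nonneg E.card)
      refine le_of_mul_le_mul_left ?_ hE
      linarith

theorem harmonic_le_three_mul_log {m : ℕ} (hm : 1 ≤ m) :
    (harmonic m : ℝ) ≤ 3 * Real.log ((m : ℝ) + 1) := by
  have h1 := harmonic_le_one_add_log m
  have hm' : (1 : ℝ) ≤ m := by exact_mod_cast hm
  have h2 : Real.log m ≤ Real.log ((m : ℝ) + 1) := Real.log_le_log (by linarith) (by linarith)
  have h3 : Real.log 2 ≤ Real.log ((m : ℝ) + 1) := Real.log_le_log (by norm_num) (by linarith)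
  -- Needed only in the form 1 ≤ 2 log 2 ≤ 2 log (m + 1).
  have := Real.log_two_gt_d9
  linarith

theorem IsNormedBy.uncondParam_le_log (hb : IsNormedBy b w) (hw : IsNonincreasingWeight w)
    {m : ℕ} (hm : 1 ≤ m) :
    uncondParam b m ≤ ENNReal.ofReal (3 * Real.log ((m : ℝ) + 1)) := by
  refine iSup₂_le fun A hA => ?_
  rw [← ofReal_norm]
  refine ENNReal.ofReal_le_ofReal ?_
  refine (hb.norm_proj_le hw A).trans (le_trans ?_ (harmonic_le_three_mul_log hm))
  unfold harmonic
  push_cast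
  exact Finset.sum_le_sum_of_subset_of_nonneg (Finset.range_mono hA) fun n _ _ => by positivity

/-! ### Lower bounds for the unconditionality parameters -/

/-- Leibniz: the sum is u 0 minus a shorter alternating sum of the shifted sequence. -/
theorem alternating_sum_mem_Icc {u : ℕ → ℝ} (hu : Antitone u) (hu0 : ∀ n, 0 ≤ u n) (n : ℕ) :
    ∑ k ∈ Finset.range n, (-1) ^ k * u k ∈ Set.Icc 0 (u 0) := by
  induction n generalizing u with
  | zero => simp [hu0]
  | succ n ih =>
    have := ih (u := fun k => u (k + 1)) (fun i j hij => hu (by omega)) fun k => hu0 _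
    have h1 : u 1 ≤ u 0 := hu (by omega)
    rw [Finset.sum_range_succ']
    simp only [pow_succ, pow_zero, one_mul, mul_neg, mul_one, neg_mul, Finset.sum_neg_distrib]
    simp only [Set.mem_Icc, zero_add] at this ⊢
    exact ⟨by linarith, by linarith⟩

theorem Antitone.sum_le_sum_range_card {c : ℕ → ℝ} (hc : Antitone c) (E : Finset ℕ) :
    ∑ n ∈ E, c n ≤ ∑ n ∈ Finset.range E.card, c n := by
  induction E using Finset.induction_on_max with
  | empty => simp
  | insert q E hq ih =>
    have hqE : q ∉ E := fun h => lt_irrefl _ (hq q h)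
    have hcard : E.card ≤ q := by
      simpa using Finset.card_le_card (fun x hx => Finset.mem_range.mpr (hq x hx) :
        E ⊆ Finset.range q)
    rw [Finset.sum_insert hqE, Finset.card_insert_of_notMem hqE, Finset.sum_range_succ]
    linarith [hc hcard]

/-- The alternating vector with non-increasing moduli `c` of its coefficients is controlled by the
Marcinkiewicz norm of `c`. -/
theorem IsNormedBy.norm_alternating_le (hb : IsNormedBy b w) (hw : IsNonincreasingWeight w)
    {c : ℕ → ℝ} (hc : Antitone c) (hc0 : ∀ n, 0 ≤ c n) {K : ℝ}
    (hK : ∀ n, 1 ≤ n → primitiveSeq w n * ∑ k ∈ Finset.range n, c k ≤ K * n) (N : ℕ) :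
    ‖∑ k ∈ Finset.range N, (((-1) ^ k * c k : ℝ) : 𝕜) • b k‖ ≤ 2 * K := by
  have hK1 : w 1 * c 0 ≤ K := by simpa using hK 1 le_rfl
  have hK0 : 0 ≤ K := (mul_nonneg hw.pos_one.le (hc0 0)).trans hK1
  refine hb.norm_le _ _ fun B M => ?_
  simp only [SchauderBasis.coord_sum_smul]
  set m := B.card with hm
  have hB : ∑ k ∈ B, c k ≤ ∑ k ∈ Finset.range m, c k := hc.sum_le_sum_range_card B
  have hB0 : 0 ≤ ∑ k ∈ B, c k := Finset.sum_nonneg fun n _ => hc0 n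
  have hw0 : 0 ≤ w (m + 1) := hw.nonneg _ (by omega)
  have h1 : primitiveSeq w m / m * ∑ k ∈ B, c k ≤ K := by
    rcases Nat.eq_zero_or_pos m with h0 | hpos
    · simpa [h0] using hK0
    · have hm0 : (0 : ℝ) < m := by exact_mod_cast hpos
      rw [div_mul_eq_mul_div, div_le_iff₀ hm0]
      exact (mul_le_mul_of_nonneg_left hB (hw.primitiveSeq_nonneg m)).trans (hK m hpos)
  have h1' : w (m + 1) * ∑ k ∈ B, c k ≤ K := by
    rcases Nat.eq_zero_or_pos m with h0 | hpos
    · have : B = ∅ := Finset.card_eq_zero.mp (hm ▸ h0)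
      simpa [this] using hK0
    · refine le_trans (mul_le_mul_of_nonneg_right ?_ hB0) h1
      have hm0 : (0 : ℝ) < m := by exact_mod_cast hpos
      rw [le_div_iff₀ hm0, mul_comm]
      exact hw.card_mul_le_primitiveSeq (Nat.le_succ m)
  have hfirst : ∑ k ∈ B, ‖(if k ∈ Finset.range N then (((-1) ^ k * c k : ℝ) : 𝕜) else 0)‖ ≤
      ∑ k ∈ B, c k := by
    refine Finset.sum_le_sum fun k _ => ?_
    split_ifs
    · rw [RCLike.norm_ofReal, abs_mul, abs_pow, abs_neg, abs_one, one_pow, one_mul,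
        abs_of_nonneg (hc0 k)]
    · simpa using hc0 k
  set u : ℕ → ℝ := fun k => w (m + k + 1) * c k with hu
  have hu0 : ∀ k, 0 ≤ u k := fun k => mul_nonneg (hw.nonneg _ (by omega)) (hc0 k)
  have hanti : Antitone u := fun i j hij =>
    mul_le_mul (hw.nonincreasing _ _ (by omega) (by omega)) (hc hij) (hc0 j)
      (hw.nonneg _ (by omega))
  -- The alternating sum over a whole initial segment is at most u 0 ≤ K. Deleting the indices in B
  -- costs at most w_{m+1} ∑_B c, which is at most K as well.
  have hsecond : ‖∑ k ∈ Finset.range M \ B, (w (m + k + 1) : 𝕜) *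
      (if k ∈ Finset.range N then (((-1) ^ k * c k : ℝ) : 𝕜) else 0)‖ ≤ K + K := by
    set R := Finset.range (min M N)
    have hreal : ∑ k ∈ Finset.range M \ B, (w (m + k + 1) : 𝕜) *
        (if k ∈ Finset.range N then (((-1) ^ k * c k : ℝ) : 𝕜) else 0) =
        ((∑ k ∈ R \ B, (-1) ^ k * u k : ℝ) : 𝕜) := by
      rw [RCLike.ofReal_sum]
      symm
      refine Finset.sum_subset_zero_on_sdiff ?_ ?_ ?_
      · exact Finset.sdiff_subset_sdiff (Finset.range_mono (min_le_left _ _)) subset_rfl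
      · intro k hk
        simp only [R, Finset.mem_sdiff, Finset.mem_range] at hk
        rw [if_neg, mul_zero]
        exact fun hkN => hk.2 ⟨lt_min hk.1.1 (Finset.mem_range.mp hkN), hk.1.2⟩
      · intro k hk
        simp only [R, Finset.mem_sdiff, Finset.mem_range] at hk
        rw [if_pos (by simp only [Finset.mem_range]; omega), ← RCLike.ofReal_mul]
        congr 1
        simp only [hu]
        ring
    rw [hreal, RCLike.norm_ofReal]
    have hsplit := Finset.sum_inter_add_sum_sdiff R B (fun k => (-1) ^ k * u k)
    have halt := alternating_sum_mem_Icc hanti hu0 (min M N)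
    have hinter : |∑ k ∈ R ∩ B, (-1) ^ k * u k| ≤ w (m + 1) * ∑ k ∈ B, c k := by
      refine (Finset.abs_sum_le_sum_abs _ _).trans ?_
      rw [Finset.mul_sum]
      refine le_trans (Finset.sum_le_sum (g := fun k => w (m + 1) * c k) fun k _ => ?_)
        (Finset.sum_le_sum_of_subset_of_nonneg Finset.inter_subset_right fun k _ _ =>
          mul_nonneg hw0 (hc0 k))
      rw [abs_mul, abs_pow, abs_neg, abs_one, one_pow, one_mul, abs_of_nonneg (hu0 k)]
      exact mul_le_mul_of_nonneg_right (hw.nonincreasing _ _ (by omega) (by omega)) (hc0 k)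
    have hu00 : u 0 ≤ K := (mul_le_mul_of_nonneg_right
      (hw.nonincreasing 1 _ le_rfl (by omega)) (hc0 0)).trans hK1
    obtain ⟨h2, h3⟩ := halt
    have h4 := abs_le.mp (hinter.trans h1')
    rw [abs_le]
    constructor <;> linarith
  have h5 := mul_le_mul_of_nonneg_left hfirst
    (div_nonneg (hw.primitiveSeq_nonneg m) (Nat.cast_nonneg m))
  unfold normTerm
  rw [← hm]
  linarith

/-- In the term with B = ∅ all summands of one parity have the same sign. One factor 1/2 comes from
the norm, the other from choosing the larger parity class. -/
theorem IsNormedBy.le_norm_proj_alternating (hb : IsNormedBy b w) (hw : IsNonincreasingWeight w)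
    {c : ℕ → ℝ} (hc0 : ∀ n, 0 ≤ c n) (N : ℕ) :
    ∃ A : Finset ℕ, 1 / 4 * ∑ k ∈ Finset.range N, w (k + 1) * c k ≤
      ‖GeneralSchauderBasis.proj b A
        (∑ k ∈ Finset.range N, (((-1) ^ k * c k : ℝ) : 𝕜) • b k)‖ := by
  have key : ∀ (A : Finset ℕ) (θ : ℝ), |θ| = 1 → A ⊆ Finset.range N →
      (∀ k ∈ A, (-1 : ℝ) ^ k = θ) → 1 / 2 * ∑ k ∈ A, w (k + 1) * c k ≤
      ‖GeneralSchauderBasis.proj b A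
        (∑ k ∈ Finset.range N, (((-1) ^ k * c k : ℝ) : 𝕜) • b k)‖ := by
    intro A θ hθ hA hsign
    refine le_trans (le_of_eq ?_) (hb.term_le _ ∅ N)
    simp only [GeneralSchauderBasis.proj_apply, SchauderBasis.coord_sum_smul b A,
      SchauderBasis.coord_sum_smul b (Finset.range N)]
    simp only [normTerm, Finset.sum_empty, mul_zero, zero_add, Finset.card_empty,
      Finset.sdiff_empty]
    congr 1
    have hval : ∑ k ∈ Finset.range N, (w (k + 1) : 𝕜) * (if k ∈ A then
        (if k ∈ Finset.range N then (((-1) ^ k * c k : ℝ) : 𝕜) else 0) else 0) =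
        ((θ * ∑ k ∈ A, w (k + 1) * c k : ℝ) : 𝕜) := by
      rw [Finset.mul_sum, RCLike.ofReal_sum]
      symm
      refine Finset.sum_subset_zero_on_sdiff hA ?_ ?_
      · intro k hk
        rw [if_neg (Finset.mem_sdiff.mp hk).2, mul_zero]
      · intro k hk
        rw [if_pos hk, if_pos (hA hk), ← RCLike.ofReal_mul, hsign k hk]
        congr 1
        ring
    rw [hval, RCLike.norm_ofReal, abs_mul, hθ, one_mul, abs_of_nonneg]
    exact Finset.sum_nonneg fun k _ => mul_nonneg (hw.nonneg _ (by omega)) (hc0 k)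
  have heven := key ((Finset.range N).filter Even) 1 (by simp) (Finset.filter_subset _ _)
    fun k hk => (Finset.mem_filter.mp hk).2.neg_one_pow
  have hodd := key ((Finset.range N).filter fun k => ¬ Even k) (-1) (by simp)
    (Finset.filter_subset _ _)
    fun k hk => (Nat.not_even_iff_odd.mp (Finset.mem_filter.mp hk).2).neg_one_pow
  have hsplit := Finset.sum_filter_add_sum_filter_not (Finset.range N) Even
    fun k => w (k + 1) * c k
  rcases le_total (∑ k ∈ (Finset.range N).filter Even, w (k + 1) * c k)
    (∑ k ∈ (Finset.range N).filter fun k => ¬ Even k, w (k + 1) * c k) with h | h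
  · exact ⟨_, le_trans (by linarith) hodd⟩
  · exact ⟨_, le_trans (by linarith) heven⟩

/-- The constant 8K combines the norm bound 2K of the alternating vector with the factor 1/4 for its
projection. -/
theorem IsNormedBy.le_uncondParamTilde (hb : IsNormedBy b w) (hw : IsNonincreasingWeight w)
    {c : ℕ → ℝ} (hc : Antitone c) (hc0 : ∀ n, 0 ≤ c n) {K : ℝ} (hK0 : 0 < K)
    (hK : ∀ n, 1 ≤ n → primitiveSeq w n * ∑ k ∈ Finset.range n, c k ≤ K * n) (N : ℕ) :
    ENNReal.ofReal ((∑ k ∈ Finset.range N, w (k + 1) * c k) / (8 * K)) ≤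
      uncondParamTilde b N := by
  obtain ⟨A, hA⟩ := hb.le_norm_proj_alternating hw hc0 N
  have hf := hb.norm_alternating_le hw hc hc0 hK N
  set f : X := ∑ k ∈ Finset.range N, (((-1) ^ k * c k : ℝ) : 𝕜) • b k with hfdef
  have hnorm : ‖(((2 * K)⁻¹ : ℝ) : 𝕜)‖ = (2 * K)⁻¹ := by
    rw [RCLike.norm_ofReal, abs_of_pos (by positivity)]
  refine le_iSup₂_of_le A ((((2 * K)⁻¹ : ℝ) : 𝕜) • f) (le_iSup₂_of_le ?_ ?_ ?_)
  · rw [norm_smul, hnorm, inv_mul_le_iff₀ (by positivity), mul_one]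
    exact hf
  · intro n hn
    rw [map_smul, hfdef, SchauderBasis.coord_sum_smul, if_neg (by simpa using hn), smul_zero]
  · rw [← ofReal_norm]
    refine ENNReal.ofReal_le_ofReal ?_
    rw [map_smul, norm_smul, hnorm, div_le_iff₀ (by positivity)]
    have : (2 * K)⁻¹ * ‖GeneralSchauderBasis.proj b A f‖ * (8 * K) =
        4 * ‖GeneralSchauderBasis.proj b A f‖ := by
      field_simp
      ring
    rw [this]
    linarith

/-! ### Conditionality -/

/-- The ordered expansion identifies the unconditional sum with x, after which uniform boundedness
applies. -/
theorem IsUnconditional.exists_norm_proj_le [CompleteSpace X] (h : IsUnconditional b) :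
    ∃ C : ℝ, ∀ A : Finset ℕ, ‖GeneralSchauderBasis.proj b A‖ ≤ C := by
  let b' : UnconditionalSchauderBasis ℕ 𝕜 X :=
    { basis := b.basis
      coord := b.coord
      ortho := b.ortho
      expansion := fun x => by
        have h1 := (h x).hasSum
        have h2 := h1.tendsto_sum_nat
        have h3 := SchauderBasis.tendsto_proj b x
        simp only [SchauderBasis.proj_apply] at h3
        rwa [tendsto_nhds_unique h2 h3] at h1 }
  exact UnconditionalSchauderBasis.exists_norm_proj_le b'

/-- Each step adds to c a flat block of height 1/σ_M on M places, which raises the pairing by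
exactly 1. With M large enough the block is negligible where the old c matters, and the old c takes
up at most half of the bound elsewhere, so the Marcinkiewicz norm stays below 2. -/
theorem IsNonincreasingWeight.exists_large_pairing (hw : IsNonincreasingWeight w)
    (h1 : UnboundedSeq (primitiveSeq w)) (h2 : UnboundedSeq (dualSeq (primitiveSeq w))) (K : ℕ) :
    ∃ (c : ℕ → ℝ) (N : ℕ), Antitone c ∧ (∀ n, 0 ≤ c n) ∧ (∀ n, N ≤ n → c n = 0) ∧
      (∀ n, 1 ≤ n → primitiveSeq w n * ∑ k ∈ Finset.range n, c k ≤ (2 - (1 / 2) ^ K) * n) ∧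
      (K : ℝ) ≤ ∑ k ∈ Finset.range N, w (k + 1) * c k := by
  induction K with
  | zero => exact ⟨fun _ => 0, 0, fun _ _ _ => le_rfl, by simp, by simp,
      by intros; norm_num, by simp⟩
  | succ K ih =>
    obtain ⟨c, N, hc, hc0, hcN, hcK, hcw⟩ := ih
    set S := ∑ k ∈ Finset.range N, c k with hS
    have hSle : ∀ n, ∑ k ∈ Finset.range n, c k ≤ S := by
      intro n
      calc ∑ k ∈ Finset.range n, c k ≤ ∑ k ∈ Finset.range (max n N), c k :=
            Finset.sum_le_sum_of_subset_of_nonneg (Finset.range_mono (le_max_left _ _))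
              fun k _ _ => hc0 k
        _ = S := (Finset.sum_subset (Finset.range_mono (le_max_right _ _)) fun k _ hk =>
              hcN k (by simpa using hk)).symm
    -- Unboundedness of the dual sequence: from L on, the old c contributes at most n/2.
    obtain ⟨L, hL1, hL⟩ := h2 (2 * S)
    have hsL := hw.primitiveSeq_pos hL1
    have hfar : ∀ n, L ≤ n → primitiveSeq w n * S ≤ n / 2 := by
      intro n hn
      have hS0 : 0 ≤ S := Finset.sum_nonneg fun k _ => hc0 k
      rw [dualSeq, lt_div_iff₀ hsL] at hL
      have h3 := hw.mul_primitiveSeq_le hn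
      have hn0 : 0 ≤ primitiveSeq w n := hw.primitiveSeq_nonneg n
      refine le_of_mul_le_mul_left ?_ hsL
      have h4 := mul_le_mul_of_nonneg_left hL.le hn0
      linarith
    -- Unboundedness of σ: up to L, the new block contributes at most (1/2)^(K+1) n, precisely the
    -- increase of the bound.
    obtain ⟨M₀, hM₀1, hM₀⟩ := h1 (2 ^ (K + 1) * primitiveSeq w L)
    set M := max M₀ N
    have hM1 : 1 ≤ M := hM₀1.trans (le_max_left _ _)
    have hM : 2 ^ (K + 1) * primitiveSeq w L ≤ primitiveSeq w M :=
      hM₀.le.trans (hw.primitiveSeq_monotone (le_max_left _ _))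
    have hsM := hw.primitiveSeq_pos hM1
    set d : ℕ → ℝ := fun k => if k < M then (primitiveSeq w M)⁻¹ else 0 with hd
    have hd0 : ∀ k, 0 ≤ d k := fun k => by
      simp only [hd]
      split_ifs
      · positivity
      · rfl
    have hdsum : ∀ n, ∑ k ∈ Finset.range n, d k = (min n M : ℕ) * (primitiveSeq w M)⁻¹ := by
      intro n
      simp only [hd]
      rw [← Finset.sum_filter, Finset.sum_const, nsmul_eq_mul]
      congr 2
      have : (Finset.range n).filter (· < M) = Finset.range (min n M) := by
        ext k
        simp
      rw [this, Finset.card_range]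
    refine ⟨fun k => c k + d k, M, ?_, fun n => add_nonneg (hc0 n) (hd0 n), ?_, ?_, ?_⟩
    · refine hc.add fun i j hij => ?_
      simp only [hd]
      split_ifs
      · rfl
      · omega
      · positivity
      · rfl
    · intro n hn
      simp only [hd]
      rw [hcN n ((le_max_right _ _).trans hn), if_neg (not_lt.mpr hn), add_zero]
    · intro n hn
      have hn0 : (0 : ℝ) < n := by exact_mod_cast hn
      rw [Finset.sum_add_distrib, mul_add, hdsum]
      have hpow : (1 / 2 : ℝ) ^ (K + 1) = (1 / 2) * (1 / 2) ^ K := pow_succ' _ _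
      rcases le_total n L with hnL | hnL
      · have hd1 : primitiveSeq w n * ((min n M : ℕ) * (primitiveSeq w M)⁻¹) ≤
            (1 / 2) ^ (K + 1) * n := by
          have hmin : ((min n M : ℕ) : ℝ) ≤ n := by exact_mod_cast min_le_left _ _
          have hsn := hw.primitiveSeq_monotone hnL
          have hratio : primitiveSeq w L * (primitiveSeq w M)⁻¹ ≤ (1 / 2) ^ (K + 1) := by
            rw [← div_eq_mul_inv, div_le_iff₀ hsM, one_div, inv_pow, inv_mul_eq_div,
              le_div_iff₀ (by positivity)]
            linarith
          calc primitiveSeq w n * ((min n M : ℕ) * (primitiveSeq w M)⁻¹)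
              ≤ primitiveSeq w L * (n * (primitiveSeq w M)⁻¹) := by gcongr
            _ = (primitiveSeq w L * (primitiveSeq w M)⁻¹) * n := by ring
            _ ≤ _ := mul_le_mul_of_nonneg_right hratio hn0.le
        have := hcK n hn
        rw [hpow] at hd1 ⊢
        nlinarith
      -- Beyond L the total is at most n + n/2, which is within the bound because (1/2)^(K+1) ≤ 1/2.
      · have hd2 : primitiveSeq w n * ((min n M : ℕ) * (primitiveSeq w M)⁻¹) ≤ n := by
          rw [← mul_assoc, ← div_eq_mul_inv, div_le_iff₀ hsM]
          rcases le_total n M with hnM | hnM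
          · rw [min_eq_left hnM, mul_comm]
            exact mul_le_mul_of_nonneg_left (hw.primitiveSeq_monotone hnM) hn0.le
          · rw [min_eq_right hnM, mul_comm]
            exact hw.mul_primitiveSeq_le hnM
        have hc1 := (mul_le_mul_of_nonneg_left (hSle n) (hw.primitiveSeq_nonneg n)).trans
          (hfar n hnL)
        have hp : (1 / 2 : ℝ) ^ K ≤ 1 := pow_le_one₀ (by norm_num) (by norm_num)
        rw [hpow]
        nlinarith
    · simp only [mul_add, Finset.sum_add_distrib]
      have e1 : ∑ k ∈ Finset.range M, w (k + 1) * c k = ∑ k ∈ Finset.range N, w (k + 1) * c k :=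
        (Finset.sum_subset (Finset.range_mono (le_max_right _ _)) fun k _ hk => by
          rw [hcN k (by simpa using hk), mul_zero]).symm
      have e2 : ∑ k ∈ Finset.range M, w (k + 1) * d k = 1 := by
        rw [Finset.sum_congr rfl fun k hk => by
          rw [show d k = (primitiveSeq w M)⁻¹ from if_pos (Finset.mem_range.mp hk)],
          ← Finset.sum_mul, ← primitiveSeq_eq_sum_range, mul_inv_cancel₀ hsM.ne']
      rw [e1, e2]
      push_cast
      linarith

theorem IsNormedBy.not_isUnconditional [CompleteSpace X] (hb : IsNormedBy b w)
    (hw : IsNonincreasingWeight w) (h1 : UnboundedSeq (primitiveSeq w))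
    (h2 : UnboundedSeq (dualSeq (primitiveSeq w))) : ¬ IsUnconditional b := by
  intro h
  obtain ⟨C, hC⟩ := h.exists_norm_proj_le
  have hC0 : 0 ≤ C := (norm_nonneg _).trans (hC ∅)
  obtain ⟨K, hK⟩ := exists_nat_gt (16 * C)
  obtain ⟨c, N, hc, hc0, -, hcK, hcw⟩ := hw.exists_large_pairing h1 h2 K
  have hcK' : ∀ n, 1 ≤ n → primitiveSeq w n * ∑ k ∈ Finset.range n, c k ≤ 2 * n := by
    intro n hn
    refine (hcK n hn).trans (mul_le_mul_of_nonneg_right ?_ (Nat.cast_nonneg n))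
    have : (0 : ℝ) ≤ (1 / 2) ^ K := by positivity
    linarith
  have h3 := (hb.le_uncondParamTilde hw hc hc0 two_pos hcK' N).trans
    (uncondParamTilde_le_uncondParam b N)
  have h4 : uncondParam b N ≤ ENNReal.ofReal C := by
    refine iSup₂_le fun A _ => ?_
    rw [← ofReal_norm]
    exact ENNReal.ofReal_le_ofReal (hC A)
  have h5 := (ENNReal.ofReal_le_ofReal_iff hC0).mp (h3.trans h4)
  linarith

end Parameters

/-! ### Regularity of sequences -/

theorem LRP.exists_factor {u : ℕ → ℝ} (hu : ∀ m, 1 ≤ m → 0 < u m) (h : LRP u) (K : ℝ) :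
    ∃ R : ℕ, 1 ≤ R ∧ ∀ n, 1 ≤ n → K * u n ≤ u (R * n) := by
  obtain ⟨r, hr, hrn⟩ := h
  obtain ⟨j, hj⟩ := pow_unbounded_of_one_lt K (one_lt_two (α := ℝ))
  have hpow : ∀ j n, 1 ≤ n → 2 ^ j * u n ≤ u (r ^ j * n) := by
    intro j
    induction j with
    | zero => simp
    | succ j ih =>
      intro n hn
      have h1 := hrn (r ^ j * n) (Nat.mul_pos (pow_pos hr j) hn)
      have h2 := ih n hn
      rw [pow_succ', pow_succ', mul_assoc, mul_assoc]
      linarith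
  exact ⟨r ^ j, Nat.one_le_pow _ _ hr, fun n hn =>
    (mul_le_mul_of_nonneg_right hj.le (hu n hn).le).trans (hpow j n hn)⟩

theorem LRP.unboundedSeq {u : ℕ → ℝ} (hu : ∀ m, 1 ≤ m → 0 < u m) (h : LRP u) :
    UnboundedSeq u := by
  intro C
  have h1 := hu 1 le_rfl
  obtain ⟨R, hR, hRn⟩ := h.exists_factor hu ((C + 1) / u 1)
  refine ⟨R, hR, ?_⟩
  have := hRn 1 le_rfl
  rw [div_mul_cancel₀ _ h1.ne', mul_one] at this
  linarith

/-- Induction on n by splitting at q = ⌊n/R⌋. Since 2 u_q ≤ u_n, the lower part takes half of the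
bound. The upper part has at most R(q+1) terms, each at most C u_n/(q+1), and takes the other half.
-/
theorem LRP.exists_sum_div_le {u : ℕ → ℝ} (hu : ∀ m, 1 ≤ m → 0 < u m) (hinc : EssIncreasing u)
    (h : LRP u) :
    ∃ K : ℝ, 0 < K ∧ ∀ n, 1 ≤ n → ∑ k ∈ Finset.Icc 1 n, u k / k ≤ K * u n := by
  obtain ⟨C, hC, hCu⟩ := hinc
  obtain ⟨R, hR, hRu⟩ := h.exists_factor hu (2 * C)
  have hR0 : (0 : ℝ) < R := by exact_mod_cast hR
  refine ⟨2 * R * C, by positivity, fun n => ?_⟩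
  induction n using Nat.strong_induction_on with
  | _ n ih =>
    intro hn
    have hun := hu n hn
    -- R = 1 is impossible, since it would give 2C u_n ≤ u_n ≤ C u_n; excluding it ensures q < n.
    by_cases hR1 : R = 1
    · have h1 := hRu n hn
      rw [hR1, one_mul] at h1
      have h2 := hCu n n hn le_rfl
      nlinarith
    obtain ⟨q, hqn, hqR, hlt⟩ : ∃ q, q < n ∧ R * q ≤ n ∧ n < R * (q + 1) :=
      ⟨n / R, Nat.div_lt_self hn (by omega), Nat.mul_div_le n R, Nat.lt_mul_div_succ n hR⟩
    have hlow : ∑ k ∈ Finset.Icc 1 q, u k / k ≤ R * C * u n := by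
      rcases Nat.eq_zero_or_pos q with h0 | hpos
      · rw [h0]
        simp only [zero_lt_one, Finset.Icc_eq_empty_of_lt, Finset.sum_empty]
        positivity
      · have h1 := ih q hqn hpos
        have h2 := hRu q hpos
        have h3 := hCu (R * q) n (Nat.mul_pos hR hpos) hqR
        have h4 : 2 * u q ≤ u n := by
          refine le_of_mul_le_mul_left ?_ hC
          linarith
        have h5 := mul_le_mul_of_nonneg_left h4 (mul_pos hR0 hC).le
        linarith
    have hhigh : ∑ k ∈ Finset.Ioc q n, u k / k ≤ R * C * u n := by
      have hbound : ∀ k ∈ Finset.Ioc q n, u k / k ≤ C * u n / (q + 1) := by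
        intro k hk
        rw [Finset.mem_Ioc] at hk
        have hqk : (q : ℝ) + 1 ≤ k := by exact_mod_cast hk.1
        exact div_le_div₀ (by positivity) (hCu k n (by omega) hk.2) (by positivity) hqk
      refine (Finset.sum_le_card_nsmul _ _ _ hbound).trans ?_
      rw [nsmul_eq_mul, Nat.card_Ioc]
      have hcard : ((n - q : ℕ) : ℝ) ≤ R * (q + 1) := by
        have h2 : n - q ≤ R * (q + 1) := by omega
        exact_mod_cast h2
      calc ((n - q : ℕ) : ℝ) * (C * u n / (q + 1)) ≤ R * (q + 1) * (C * u n / (q + 1)) :=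
            mul_le_mul_of_nonneg_right hcard (by positivity)
        _ = R * C * u n := by field_simp
    have hsplit : ∑ k ∈ Finset.Icc 1 n, u k / k =
        ∑ k ∈ Finset.Icc 1 q, u k / k + ∑ k ∈ Finset.Ioc q n, u k / k := by
      rw [← Finset.sum_union]
      · congr 1
        ext k
        simp only [Finset.mem_union, Finset.mem_Icc, Finset.mem_Ioc]
        omega
      · rw [Finset.disjoint_left]
        intro k
        simp only [Finset.mem_Icc, Finset.mem_Ioc]
        omega
    rw [hsplit]
    linarith

theorem dualSeq_pos {s : ℕ → ℝ} (hs : ∀ m, 1 ≤ m → 0 < s m) (m : ℕ) (hm : 1 ≤ m) :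
    0 < dualSeq s m :=
  div_pos (by exact_mod_cast hm) (hs m hm)

/-- The weight is the running minimum of s_k/k. It is comparable to s_n/n because the dual sequence
is essentially increasing, and the LRP makes the sums of s_k/k comparable to s_m. -/
theorem LRP.exists_weight {s : ℕ → ℝ} (hs : ∀ m, 1 ≤ m → 0 < s m) (hinc : EssIncreasing s)
    (hdual : EssIncreasing (dualSeq s)) (h : LRP s) :
    ∃ w : ℕ → ℝ, IsNonincreasingWeight w ∧ SeqEquiv (primitiveSeq w) s := by
  have hne : ∀ n : ℕ, (Finset.Icc 1 (max n 1)).Nonempty := fun n =>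
    ⟨1, Finset.mem_Icc.mpr ⟨le_rfl, le_max_right _ _⟩⟩
  let w : ℕ → ℝ := fun n => (Finset.Icc 1 (max n 1)).inf' (hne n) fun k => s k / k
  have hpos : ∀ n, 0 < w n := by
    intro n
    refine (Finset.lt_inf'_iff _).mpr fun k hk => ?_
    have hk1 := (Finset.mem_Icc.mp hk).1
    exact div_pos (hs k hk1) (by exact_mod_cast hk1)
  have hle : ∀ n, 1 ≤ n → w n ≤ s n / n := fun n hn =>
    Finset.inf'_le _ (Finset.mem_Icc.mpr ⟨hn, le_max_left _ _⟩)
  have hw : IsNonincreasingWeight w :=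
    { nonneg := fun n _ => (hpos n).le
      pos_one := hpos 1
      nonincreasing := fun m n _ hmn => Finset.inf'_mono _
        (Finset.Icc_subset_Icc le_rfl (max_le_max hmn le_rfl)) (hne m) }
  obtain ⟨C, hC, hCs⟩ := hdual
  obtain ⟨K, hK, hKs⟩ := h.exists_sum_div_le hs hinc
  have hge : ∀ n, 1 ≤ n → s n ≤ C * (n * w n) := by
    intro n hn
    have hn0 : (0 : ℝ) < n := by exact_mod_cast hn
    have h1 : s n / (C * n) ≤ w n := by
      refine Finset.le_inf' _ _ fun k hk => ?_
      rw [Finset.mem_Icc, max_eq_left hn] at hk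
      have h2 := hCs k n hk.1 hk.2
      have hk0 : (0 : ℝ) < k := by exact_mod_cast hk.1
      have hsk := hs k hk.1
      have hsn := hs n hn
      rw [dualSeq, dualSeq, ← mul_div_assoc, div_le_div_iff₀ hsk hsn] at h2
      rw [div_le_div_iff₀ (by positivity) hk0]
      linarith
    rw [div_le_iff₀ (by positivity)] at h1
    linarith
  refine ⟨w, hw, max K C, lt_max_of_lt_left hK, fun m hm => ⟨?_, ?_⟩⟩
  · calc primitiveSeq w m ≤ ∑ k ∈ Finset.Icc 1 m, s k / k :=
          Finset.sum_le_sum fun k hk => hle k (Finset.mem_Icc.mp hk).1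
      _ ≤ K * s m := hKs m hm
      _ ≤ max K C * s m := mul_le_mul_of_nonneg_right (le_max_left _ _) (hs m hm).le
  · calc s m ≤ C * (m * w m) := hge m hm
      _ ≤ C * primitiveSeq w m :=
          mul_le_mul_of_nonneg_left (hw.card_mul_le_primitiveSeq le_rfl) hC.le
      _ ≤ max K C * primitiveSeq w m :=
          mul_le_mul_of_nonneg_right (le_max_right _ _) (hw.primitiveSeq_nonneg m)

theorem UnboundedSeq.of_seqEquiv {p s : ℕ → ℝ} (hps : SeqEquiv p s) (h : UnboundedSeq s) :
    UnboundedSeq p := by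
  obtain ⟨C, hC, hCps⟩ := hps
  intro K
  obtain ⟨m, hm, hmK⟩ := h (C * K)
  exact ⟨m, hm, lt_of_mul_lt_mul_left (hmK.trans_le (hCps m hm).2) hC.le⟩

theorem SeqEquiv.dualSeq {p s : ℕ → ℝ} (hp : ∀ m, 1 ≤ m → 0 < p m) (hs : ∀ m, 1 ≤ m → 0 < s m)
    (hps : SeqEquiv p s) : SeqEquiv (dualSeq p) (dualSeq s) := by
  obtain ⟨C, hC, hCps⟩ := hps
  refine ⟨C, hC, fun m hm => ?_⟩
  obtain ⟨h1, h2⟩ := hCps m hm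
  have hpm := hp m hm
  have hsm := hs m hm
  have hm0 : (0 : ℝ) ≤ m := Nat.cast_nonneg m
  unfold _root_.dualSeq
  constructor
  · rw [← mul_div_assoc, div_le_div_iff₀ hpm hsm]
    nlinarith
  · rw [← mul_div_assoc, div_le_div_iff₀ hsm hpm]
    nlinarith

theorem SeqEquiv.ennSeqEquiv {p s : ℕ → ℝ} (hps : SeqEquiv p s) :
    ENNSeqEquiv (fun m => ENNReal.ofReal (p m)) (fun m => ENNReal.ofReal (s m)) := by
  obtain ⟨C, hC, hCps⟩ := hps
  refine ⟨C.toNNReal, fun m hm => ?_⟩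
  change _ ≤ ENNReal.ofReal C * _ ∧ _ ≤ ENNReal.ofReal C * _
  rw [← ENNReal.ofReal_mul hC.le, ← ENNReal.ofReal_mul hC.le]
  exact ⟨ENNReal.ofReal_le_ofReal (hCps m hm).1, ENNReal.ofReal_le_ofReal (hCps m hm).2⟩

/-! ### Logarithmic growth -/

/-- By the LRP, σ at least doubles between n and Rn, yet the weights there are at most w_n; hence
σ_n ≤ (R-1) n w_n. -/
theorem IsNonincreasingWeight.exists_primitiveSeq_le {w s : ℕ → ℝ} (hw : IsNonincreasingWeight w)
    (hs : ∀ m, 1 ≤ m → 0 < s m) (hps : SeqEquiv (primitiveSeq w) s) (h : LRP s) :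
    ∃ R : ℝ, 0 < R ∧ ∀ n, 1 ≤ n → primitiveSeq w n ≤ R * (n * w n) := by
  obtain ⟨C, hC, hCps⟩ := hps
  -- The factor 2C² absorbs the passage from σ to s and back.
  obtain ⟨R, hR, hRs⟩ := h.exists_factor hs (2 * C ^ 2)
  refine ⟨R, by exact_mod_cast hR, fun n hn => ?_⟩
  have hstep : ∀ l, primitiveSeq w (n + l) ≤ primitiveSeq w n + l * w n := by
    intro l
    induction l with
    | zero => simp
    | succ l ih =>
      rw [← add_assoc, primitiveSeq_succ]
      have := hw.nonincreasing n (n + l + 1) hn (by omega)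
      push_cast
      linarith
  have hRn : n ≤ R * n := Nat.le_mul_of_pos_left n hR
  have h1 := hstep (R * n - n)
  rw [Nat.add_sub_cancel' hRn, Nat.cast_sub hRn] at h1
  push_cast at h1
  have h2 := hRs n hn
  have h3 := (hCps (R * n) (hn.trans hRn)).2
  have h4 := (hCps n hn).1
  have h5 : 2 * primitiveSeq w n ≤ primitiveSeq w (R * n) := by
    refine le_of_mul_le_mul_left ?_ hC
    have := mul_le_mul_of_nonneg_left h4 hC.le
    nlinarith
  have := mul_nonneg (Nat.cast_nonneg n : (0 : ℝ) ≤ n) (hw.nonneg n hn)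
  linarith

/-- Take c_k = 1/σ_{k+1}. The URP gives ∑_{k≤n} 1/σ_k ≲ n/σ_n, so c has finite Marcinkiewicz norm.
The LRP gives w_k/σ_k ≳ 1/k, so the pairing dominates a harmonic sum. -/
theorem IsNormedBy.exists_log_le {𝕜 X : Type*} [RCLike 𝕜] [NormedAddCommGroup X]
    [NormedSpace 𝕜 X] {b : SchauderBasis 𝕜 X} {w s : ℕ → ℝ} (hb : IsNormedBy b w)
    (hw : IsNonincreasingWeight w) (hs : ∀ m, 1 ≤ m → 0 < s m)
    (hdual : EssIncreasing (dualSeq s)) (hps : SeqEquiv (primitiveSeq w) s)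
    (hlrp : LRP s) (hurp : URP s) :
    ∃ C : ℝ, 0 < C ∧ ∀ m : ℕ,
      ENNReal.ofReal (Real.log ((m : ℝ) + 1)) ≤ ENNReal.ofReal C * uncondParamTilde b m := by
  obtain ⟨R, hR, hRw⟩ := hw.exists_primitiveSeq_le hs hps hlrp
  obtain ⟨K, hK, hKs⟩ := LRP.exists_sum_div_le (dualSeq_pos hs) hdual hurp
  obtain ⟨C, hC, hCps⟩ := hps
  have hp : ∀ m, 1 ≤ m → 0 < primitiveSeq w m := fun m hm => hw.primitiveSeq_pos hm
  set c : ℕ → ℝ := fun k => (primitiveSeq w (k + 1))⁻¹ with hc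
  have hc0 : ∀ k, 0 ≤ c k := fun k => (inv_pos.mpr (hp _ (by omega))).le
  have hanti : Antitone c := fun i j hij =>
    inv_anti₀ (hp _ (by omega)) (hw.primitiveSeq_monotone (by omega))
  have hsum : ∀ n, 1 ≤ n →
      primitiveSeq w n * ∑ k ∈ Finset.range n, c k ≤ (C * (C * K)) * n := by
    intro n hn
    have h1 : ∑ k ∈ Finset.range n, c k ≤ C * ∑ k ∈ Finset.Icc 1 n, dualSeq s k / k := by
      have hshift : ∑ k ∈ Finset.range n, (s (k + 1))⁻¹ =
          ∑ k ∈ Finset.Icc 1 n, dualSeq s k / k := by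
        rw [← primitiveSeq_eq_sum_range (fun k => (s k)⁻¹)]
        refine Finset.sum_congr rfl fun k hk => ?_
        have hk1 := (Finset.mem_Icc.mp hk).1
        have hk0 : (k : ℝ) ≠ 0 := by exact_mod_cast (by omega : k ≠ 0)
        have := (hs k hk1).ne'
        rw [dualSeq]
        field_simp
      rw [← hshift, Finset.mul_sum]
      refine Finset.sum_le_sum fun k _ => ?_
      have hsk := hs (k + 1) (by omega)
      have hpk := hp (k + 1) (by omega)
      have h2 := (hCps (k + 1) (by omega)).2
      simp only [hc]
      rw [← div_eq_mul_inv, inv_eq_one_div, div_le_div_iff₀ hpk hsk]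
      linarith
    have hpn := hp n hn
    have hsn := hs n hn
    have h2 := hKs n hn
    have h3 : primitiveSeq w n * dualSeq s n ≤ C * n := by
      rw [dualSeq, ← mul_div_assoc, div_le_iff₀ hsn]
      have := mul_le_mul_of_nonneg_right (hCps n hn).1 (Nat.cast_nonneg n : (0 : ℝ) ≤ n)
      linarith
    calc primitiveSeq w n * ∑ k ∈ Finset.range n, c k
        ≤ primitiveSeq w n * (C * (K * dualSeq s n)) :=
          mul_le_mul_of_nonneg_left (h1.trans (mul_le_mul_of_nonneg_left h2 hC.le)) hpn.le
      _ = C * K * (primitiveSeq w n * dualSeq s n) := by ring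
      _ ≤ C * K * (C * n) := mul_le_mul_of_nonneg_left h3 (by positivity)
      _ = (C * (C * K)) * n := by ring
  set L := C * (C * K)
  have hL : 0 < L := by positivity
  refine ⟨R * (8 * L), by positivity, fun m => ?_⟩
  have hlow := hb.le_uncondParamTilde hw hanti hc0 hL hsum m
  refine le_trans ?_ (mul_le_mul_right hlow _)
  rw [← ENNReal.ofReal_mul (by positivity)]
  refine ENNReal.ofReal_le_ofReal ?_
  have hcancel : ∀ T : ℝ, R * (8 * L) * (T / (8 * L)) = R * T := fun T => by field_simp
  rw [hcancel]
  have hlog := log_add_one_le_harmonic m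
  push_cast at hlog
  refine hlog.trans ?_
  unfold harmonic
  push_cast
  rw [Finset.mul_sum]
  refine Finset.sum_le_sum fun k _ => ?_
  have h1 := hRw (k + 1) (by omega)
  have hpk := hp (k + 1) (by omega)
  have hk : (0 : ℝ) < (k : ℝ) + 1 := by positivity
  simp only [hc]
  rw [← div_eq_mul_inv, ← mul_div_assoc, inv_eq_one_div, div_le_div_iff₀ hk hpk]
  push_cast at h1
  linarith

theorem IsNormedBy.uncondParam_equiv_log {𝕜 X : Type*} [RCLike 𝕜] [NormedAddCommGroup X]
    [NormedSpace 𝕜 X] {b : SchauderBasis 𝕜 X} {w s : ℕ → ℝ} (hb : IsNormedBy b w)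
    (hw : IsNonincreasingWeight w) (hs : ∀ m, 1 ≤ m → 0 < s m)
    (hdual : EssIncreasing (dualSeq s)) (hps : SeqEquiv (primitiveSeq w) s)
    (hlrp : LRP s) (hurp : URP s) :
    ENNSeqEquiv (uncondParam b) (uncondParamTilde b) ∧
    ENNSeqEquiv (uncondParamTilde b) (fun m => ENNReal.ofReal (Real.log ((m : ℝ) + 1))) := by
  obtain ⟨C, hC, hlog⟩ := hb.exists_log_le hw hs hdual hps hlrp hurp
  have hup : ∀ m, 1 ≤ m →
      uncondParam b m ≤ ENNReal.ofReal 3 * ENNReal.ofReal (Real.log ((m : ℝ) + 1)) := by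
    intro m hm
    rw [← ENNReal.ofReal_mul (by norm_num)]
    exact hb.uncondParam_le_log hw hm
  constructor
  · refine ⟨(3 * C + 1).toNNReal, fun m hm => ?_⟩
    change _ ≤ ENNReal.ofReal (3 * C + 1) * _ ∧ _ ≤ ENNReal.ofReal (3 * C + 1) * _
    constructor
    · calc uncondParam b m ≤ ENNReal.ofReal 3 * (ENNReal.ofReal C * uncondParamTilde b m) :=
            (hup m hm).trans (mul_le_mul_right (hlog m) _)
        _ = ENNReal.ofReal (3 * C) * uncondParamTilde b m := by
            rw [← mul_assoc, ← ENNReal.ofReal_mul (by norm_num)]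
        _ ≤ _ := mul_le_mul_left (ENNReal.ofReal_le_ofReal (by linarith)) _
    · refine (uncondParamTilde_le_uncondParam b m).trans (le_mul_of_one_le_left' ?_)
      exact ENNReal.one_le_ofReal.mpr (by linarith)
  · refine ⟨(max 3 C).toNNReal, fun m hm => ?_⟩
    change _ ≤ ENNReal.ofReal (max 3 C) * _ ∧ _ ≤ ENNReal.ofReal (max 3 C) * _
    constructor
    · exact ((uncondParamTilde_le_uncondParam b m).trans (hup m hm)).trans
        (mul_le_mul_left (ENNReal.ofReal_le_ofReal (le_max_left _ _)) _)
    · exact (hlog m).trans (mul_le_mul_left (ENNReal.ofReal_le_ofReal (le_max_right _ _)) _)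

/-! ### The square roots -/

theorem dualSeq_sqrt : dualSeq (fun m : ℕ => √(m : ℝ)) = fun m : ℕ => √(m : ℝ) := by
  funext m
  exact Real.div_sqrt

theorem lrp_sqrt : LRP fun m : ℕ => √(m : ℝ) := by
  refine ⟨4, by norm_num, fun n _ => ?_⟩
  have : √(4 : ℝ) = 2 := by
    rw [show (4 : ℝ) = 2 ^ 2 by norm_num, Real.sqrt_sq (by norm_num)]
  push_cast
  rw [Real.sqrt_mul (by norm_num), this]

theorem essIncreasing_sqrt : EssIncreasing fun m : ℕ => √(m : ℝ) :=
  ⟨1, one_pos, fun m n _ hmn => by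
    rw [one_mul]
    exact Real.sqrt_le_sqrt (by exact_mod_cast hmn)⟩

/-! ### The main theorem -/

theorem mainTheorem2 (𝕜 : Type u) [RCLike 𝕜] :
    -- a conditional bidemocratic Schauder basis with Property (A) exists
    (∃ (X : Type u) (_ : NormedAddCommGroup X) (_ : NormedSpace 𝕜 X) (_ : CompleteSpace X)
        (b : SchauderBasis 𝕜 X),
        IsBidemocratic b ∧ ¬ IsUnconditional b ∧ HasPropertyA b) ∧
    ∀ s : ℕ → ℝ, (∀ m, 1 ≤ m → 0 < s m) → EssIncreasing s → EssIncreasing (dualSeq s) →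
      -- (C.1)
      (UnboundedSeq s → UnboundedSeq (dualSeq s) →
        ∀ w : ℕ → ℝ, IsNonincreasingWeight w → SeqEquiv (primitiveSeq w) s →
        ∃ (X : Type u) (_ : NormedAddCommGroup X) (_ : NormedSpace 𝕜 X) (_ : CompleteSpace X)
          (b : SchauderBasis 𝕜 X),
          IsBidemocratic b ∧ ¬ IsUnconditional b ∧ HasPropertyA b ∧
          (∀ m, 1 ≤ m →
            fundamentalFunction 𝕜 b.basis m = ENNReal.ofReal (primitiveSeq w m)) ∧
          ENNSeqEquiv (fundamentalFunction 𝕜 b.basis) (fun m => ENNReal.ofReal (s m))) ∧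
      -- (C.2)
      (LRP s → UnboundedSeq (dualSeq s) →
        (∃ w : ℕ → ℝ, IsNonincreasingWeight w ∧ SeqEquiv (primitiveSeq w) s) ∧
        ∀ w : ℕ → ℝ, IsNonincreasingWeight w → SeqEquiv (primitiveSeq w) s →
        ∃ (X : Type u) (_ : NormedAddCommGroup X) (_ : NormedSpace 𝕜 X) (_ : CompleteSpace X)
          (b : SchauderBasis 𝕜 X),
          IsBidemocratic b ∧ ¬ IsUnconditional b ∧ HasPropertyA b ∧
          (∀ m, 1 ≤ m →
            fundamentalFunction 𝕜 b.basis m = ENNReal.ofReal (primitiveSeq w m)) ∧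
          ENNSeqEquiv (fundamentalFunction 𝕜 b.basis) (fun m => ENNReal.ofReal (s m))) ∧
      -- (C.3)
      (LRP s → URP s →
        (∃ w : ℕ → ℝ, IsNonincreasingWeight w ∧ SeqEquiv (primitiveSeq w) s) ∧
        ∀ w : ℕ → ℝ, IsNonincreasingWeight w → SeqEquiv (primitiveSeq w) s →
        ∃ (X : Type u) (_ : NormedAddCommGroup X) (_ : NormedSpace 𝕜 X) (_ : CompleteSpace X)
          (b : SchauderBasis 𝕜 X),
          IsBidemocratic b ∧ ¬ IsUnconditional b ∧ HasPropertyA b ∧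
          (∀ m, 1 ≤ m →
            fundamentalFunction 𝕜 b.basis m = ENNReal.ofReal (primitiveSeq w m)) ∧
          ENNSeqEquiv (fundamentalFunction 𝕜 b.basis) (fun m => ENNReal.ofReal (s m)) ∧
          ENNSeqEquiv (uncondParam b) (uncondParamTilde b) ∧
          ENNSeqEquiv (uncondParamTilde b)
            (fun m => ENNReal.ofReal (Real.log ((m : ℝ) + 1)))) := by
  have hC1 : ∀ s : ℕ → ℝ, (∀ m, 1 ≤ m → 0 < s m) →
      UnboundedSeq s → UnboundedSeq (dualSeq s) →
      ∀ w : ℕ → ℝ, IsNonincreasingWeight w → SeqEquiv (primitiveSeq w) s →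
      ∃ (X : Type u) (_ : NormedAddCommGroup X) (_ : NormedSpace 𝕜 X) (_ : CompleteSpace X)
        (b : SchauderBasis 𝕜 X), IsNormedBy b w ∧
        IsBidemocratic b ∧ ¬ IsUnconditional b ∧ HasPropertyA b ∧
        (∀ m, 1 ≤ m →
          fundamentalFunction 𝕜 b.basis m = ENNReal.ofReal (primitiveSeq w m)) ∧
        ENNSeqEquiv (fundamentalFunction 𝕜 b.basis) (fun m => ENNReal.ofReal (s m)) := by
    intro s hs hsu hdu w hw hps
    have hp : ∀ m, 1 ≤ m → 0 < primitiveSeq w m := fun m hm => hw.primitiveSeq_pos hm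
    obtain ⟨X, i₁, i₂, i₃, b, hb⟩ := exists_schauderBasis_isNormedBy 𝕜 hw
    have hφ : ∀ m, 1 ≤ m →
        fundamentalFunction 𝕜 b.basis m = ENNReal.ofReal (primitiveSeq w m) := fun m hm =>
      hb.fundamentalFunction_eq hw hm
    refine ⟨X, i₁, i₂, i₃, b, hb, hb.isBidemocratic hw,
      hb.not_isUnconditional hw (hsu.of_seqEquiv hps) (hdu.of_seqEquiv (hps.dualSeq hp hs)),
      hb.hasPropertyA hw, hφ, ?_⟩
    obtain ⟨C, hC⟩ := hps.ennSeqEquiv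
    exact ⟨C, fun m hm => by
      rw [hφ m hm]
      exact hC m hm⟩
  constructor
  -- For the bare existence claim take s_m = √m, which is its own dual sequence and has the LRP.
  · have hpos : ∀ m : ℕ, 1 ≤ m → 0 < √(m : ℝ) := fun m hm =>
      Real.sqrt_pos.mpr (by exact_mod_cast hm)
    have hunb := lrp_sqrt.unboundedSeq hpos
    obtain ⟨w, hw, hps⟩ := lrp_sqrt.exists_weight hpos essIncreasing_sqrt
      (by rw [dualSeq_sqrt]; exact essIncreasing_sqrt)
    obtain ⟨X, i₁, i₂, i₃, b, -, h1, h2, h3, -⟩ :=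
      hC1 _ hpos hunb (by rw [dualSeq_sqrt]; exact hunb) w hw hps
    exact ⟨X, i₁, i₂, i₃, b, h1, h2, h3⟩
  · intro s hs hinc hdual
    refine ⟨fun hsu hdu w hw hps => ?_,
      fun hlrp hdu => ⟨hlrp.exists_weight hs hinc hdual, fun w hw hps => ?_⟩,
      fun hlrp hurp => ⟨hlrp.exists_weight hs hinc hdual, fun w hw hps => ?_⟩⟩
    · obtain ⟨X, i₁, i₂, i₃, b, -, h⟩ := hC1 s hs hsu hdu w hw hps
      exact ⟨X, i₁, i₂, i₃, b, h⟩
    · obtain ⟨X, i₁, i₂, i₃, b, -, h⟩ := hC1 s hs (hlrp.unboundedSeq hs) hdu w hw hps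
      exact ⟨X, i₁, i₂, i₃, b, h⟩
    · obtain ⟨X, i₁, i₂, i₃, b, hb, h1, h2, h3, h4, h5⟩ := hC1 s hs (hlrp.unboundedSeq hs)
        (LRP.unboundedSeq (dualSeq_pos hs) hurp) w hw hps
      exact ⟨X, i₁, i₂, i₃, b, h1, h2, h3, h4, h5,
        hb.uncondParam_equiv_log hw hs hdual hps hlrp hurp⟩
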